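/- **Setting.** Let $d,m\ge 0$ and let $\mathcal M\subset\mathbb R^n$ be a compact, boundaryless, embedded $d$-dimensional submanifold of class $C^{\max(2,m+1)}$. A finite nonempty set $X=\{r_i\}\subset\mathcal M$ is an $h$-$\rho$-$\delta$ set ($h,\delta>0$) if $h=\sup_{x\in\mathcal M}\min_i\|x-r_i\|$, $\#(X\cap \overline B_{kh}(y))\le\rho k^d$ for all real $k\ge1$ and all $y\in\mathbb R^n$, and $\|r_i-r_j\|\ge h\delta$ for $i\ne j$. The reach $\mathrm{rch}(\mathcal M)\in[0,\infty]$ is the supremum of the $\tau$ such that every point at distance at most $\tau$ from $\mathcal M$ has a unique nearest point in $\mathcal M$. At scale $h$ the weight is a function $\theta:[0,\infty)\to[0,\infty)$ that is non-increasing, has support $[0,c_1h]$, and satisfies $\theta(c_2h)>c_3$ and $\theta(0)\le c_4$, where $c_1>2$, $c_2$, $c_3>0$ and $c_4$ do not depend on $h$ (for example $\theta(t)=f(t/h)$ with a fixed profile $f$). For $r\in\mathcal M$ let $(q(r),H(r))$ be any minimizer of $$J(q,H)=\sum_i d(r_i,H)^2\,\theta(\|r_i-q\|)$$ over all $d$-dimensional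 affine subspaces $H\subset\mathbb R^n$ and points $q\in H$ with $r-q\perp H$, $\|q-r\|<\mathrm{rch}(\mathcal M)/2$ and $\|r_i-q\|<h$ for some $i$. For $\psi:\mathcal M\to\mathbb R$ let $x_i\in\mathbb R^d$ be the coordinates, in an orthonormal basis of the direction of $H(r)$ and with origin $q(r)$, of the orthogonal projection of $r_i$ onto $H(r)$. Consider the problem of minimizing $$\sum_i (p(x_i)-\psi(r_i))^2\,\theta(\|r_i-q(r)\|)$$ over the real polynomials $p$ in $d$ variables of total degree at most $m$. **Theorem.** For all $d$ and $m$ there is a number $k\ge3$ depending only on $d$ and $m$, with $k=3$ if $m\le1$, such that the following holds whenever $c_2\ge k$. Let $\mathcal M$ be as above and $\psi\in C^{m+1}(\mathcal M)$, and fix $\rho,\delta,c_1,c_2,c_3,c_4$. Then there are $h_0>0$ and $C>0$ such that for every $0<h<h_0$, every $h$-$\rho$-$\delta$ set $X\subset\mathcal M$, every weight $\theta$ satisfying the above conditions at scale $h$, every $r\in\mathcal M$, every minimizer $(q(r),H(r))$, and every choice of orthonormal basis, the polynomial least-squares problem has a unique solution $p_r$, and $\widetilde\psi(r):=p_r(0)$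 satisfies $$|\widetilde\psi(r)-\psi(r)|<C\,h^{m+1}.$$ In particular $C$ does not depend on $h$, $X$, $\theta$ or $r$. -/

import Mathlib

open scoped ENNReal

namespace MMLS

/-- `M` is a closed (compact, without boundary) embedded `d`-dimensional submanifold of class `C^k`
of `ℝⁿ`: around each of its points a `C^k` diffeomorphism between open subsets of `ℝⁿ` flattens
`M` onto a `d`-dimensional linear subspace. -/
structure IsClosedSubmanifold {n : ℕ} (d k : ℕ) (M : Set (EuclideanSpace ℝ (Fin n))) : Prop where
  isCompact : IsCompact M
  slice : ∀ p ∈ M, ∃ (Φ : OpenPartialHomeomorph (EuclideanSpace ℝ (Fin n))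
      (EuclideanSpace ℝ (Fin n))) (W : Submodule ℝ (EuclideanSpace ℝ (Fin n))),
    p ∈ Φ.source ∧ ContDiffOn ℝ k Φ Φ.source ∧ ContDiffOn ℝ k Φ.symm Φ.target ∧
      Module.finrank ℝ W = d ∧ ∀ x ∈ Φ.source, x ∈ M ↔ Φ x ∈ W

/-- The restriction of `ψ` to `M` is a function of class `C^k` on `M`: near every point of `M` it
agrees on `M` with a `C^k` function of the ambient space. Only the values of `ψ` on `M` matter. -/
def IsCkOn {n : ℕ} (k : ℕ) (M : Set (EuclideanSpace ℝ (Fin n)))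
    (ψ : EuclideanSpace ℝ (Fin n) → ℝ) : Prop :=
  ∀ p ∈ M, ∃ F : EuclideanSpace ℝ (Fin n) → ℝ,
    ContDiffAt ℝ k F p ∧ ∀ᶠ x in nhdsWithin p M, F x = ψ x

/-- The reach of `A`: the supremum of the `τ` such that every point at distance at most `τ` from
`A` has a unique nearest point in `A`. -/
noncomputable def reach {n : ℕ} (A : Set (EuclideanSpace ℝ (Fin n))) : ℝ≥0∞ :=
  sSup {τ | ∀ x, Metric.infEDist x A ≤ τ → ∃! p, p ∈ A ∧ edist x p = Metric.infEDist x A}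

/-- The finite set `X ⊆ M` is an `h`-`ρ`-`δ` set with respect to the `d`-dimensional domain `M`:
it has fill distance `h`, density at most `ρ` and separation at least `δ`. -/
structure IsSampleSet {n : ℕ} (d : ℕ) (M : Set (EuclideanSpace ℝ (Fin n))) (h ρ δ : ℝ)
    (X : Finset (EuclideanSpace ℝ (Fin n))) : Prop where
  subset : (X : Set (EuclideanSpace ℝ (Fin n))) ⊆ M
  nonempty : X.Nonempty
  fill : IsLUB ((fun x => Metric.infDist x (X : Set (EuclideanSpace ℝ (Fin n)))) '' M) h
  density : ∀ k : ℝ, 1 ≤ k → ∀ y : EuclideanSpace ℝ (Fin n),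
    (((X : Set (EuclideanSpace ℝ (Fin n))) ∩ Metric.closedBall y (k * h)).ncard : ℝ) ≤ ρ * k ^ d
  separation : ∀ x ∈ X, ∀ y ∈ X, x ≠ y → h * δ ≤ dist x y

/-- The conditions on the weight function `θ : [0, ∞) → [0, ∞)` at the scale `h`: it is
monotonically decaying with support `[0, c₁ h]`, and `θ (c₂ h) > c₃`, `θ 0 ≤ c₄`.
A fixed profile `f`, scaled as `θ t = f (t / h)`, has such bounds with constants that do not
depend on `h`. -/
structure IsWeight (h c₁ c₂ c₃ c₄ : ℝ) (θ : ℝ → ℝ) : Prop where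
  nonneg : ∀ t, 0 ≤ t → 0 ≤ θ t
  antitone : AntitoneOn θ (Set.Ici 0)
  support : closure {t | 0 ≤ t ∧ θ t ≠ 0} = Set.Icc 0 (c₁ * h)
  lower : c₃ < θ (c₂ * h)
  upper : θ 0 ≤ c₄

/-- The cost `J(q, H) = ∑ᵢ d(rᵢ, H)² θ(‖rᵢ - q‖)`. -/
noncomputable def J {n : ℕ} (X : Finset (EuclideanSpace ℝ (Fin n))) (θ : ℝ → ℝ)
    (q : EuclideanSpace ℝ (Fin n)) (H : AffineSubspace ℝ (EuclideanSpace ℝ (Fin n))) : ℝ :=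
  ∑ x ∈ X, Metric.infDist x (H : Set (EuclideanSpace ℝ (Fin n))) ^ 2 * θ ‖x - q‖

/-- The pair `(q, H)` is admissible for the point `r`: `H` is a `d`-dimensional affine subspace
through `q`, orthogonal to `r - q`; `q` lies in the open ball of radius `reach M / 2` around `r`,
and there is a (noise-free) sample point in the open ball of radius `h` around `q`. -/
structure IsAdmissible {n : ℕ} (d : ℕ) (M : Set (EuclideanSpace ℝ (Fin n))) (h : ℝ)
    (X : Finset (EuclideanSpace ℝ (Fin n))) (r q : EuclideanSpace ℝ (Fin n))
    (H : AffineSubspace ℝ (EuclideanSpace ℝ (Fin n))) : Prop where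
  mem : q ∈ H
  finrank : Module.finrank ℝ H.direction = d
  perp : ∀ v ∈ H.direction, inner ℝ v (r - q) = 0
  search : edist q r < reach M / 2
  proximity : ∃ x ∈ X, dist x q < h

/-- `(q, H)` minimizes the cost `J` among all pairs admissible for `r`. -/
def IsLocalCoord {n : ℕ} (d : ℕ) (M : Set (EuclideanSpace ℝ (Fin n))) (h : ℝ)
    (X : Finset (EuclideanSpace ℝ (Fin n))) (θ : ℝ → ℝ) (r q : EuclideanSpace ℝ (Fin n))
    (H : AffineSubspace ℝ (EuclideanSpace ℝ (Fin n))) : Prop :=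
  IsAdmissible d M h X r q H ∧
    ∀ q' H', IsAdmissible d M h X r q' H' → J X θ q H ≤ J X θ q' H'

/-- The weighted least-squares cost `∑ᵢ (p(xᵢ) - ψ(rᵢ))² θ(‖rᵢ - q‖)` of a polynomial `p` in `d`
variables; `xᵢ ∈ ℝᵈ` are the coordinates of the projection of `rᵢ` onto `H`, with origin `q`,
in the orthonormal basis `e` of the direction of `H`. -/
noncomputable def fitCost {n d : ℕ} (X : Finset (EuclideanSpace ℝ (Fin n))) (θ : ℝ → ℝ)
    (ψ : EuclideanSpace ℝ (Fin n) → ℝ) (q : EuclideanSpace ℝ (Fin n))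
    {W : Submodule ℝ (EuclideanSpace ℝ (Fin n))} (e : OrthonormalBasis (Fin d) ℝ W)
    (p : MvPolynomial (Fin d) ℝ) : ℝ :=
  ∑ x ∈ X, (MvPolynomial.eval
    (fun j => inner ℝ (e j : EuclideanSpace ℝ (Fin n)) (x - q)) p - ψ x) ^ 2 * θ ‖x - q‖

/-- `p` minimizes the weighted least-squares cost among the polynomials of total degree at
most `m`. -/
def IsFit {n d : ℕ} (m : ℕ) (X : Finset (EuclideanSpace ℝ (Fin n))) (θ : ℝ → ℝ)
    (ψ : EuclideanSpace ℝ (Fin n) → ℝ) (q : EuclideanSpace ℝ (Fin n))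
    {W : Submodule ℝ (EuclideanSpace ℝ (Fin n))} (e : OrthonormalBasis (Fin d) ℝ W)
    (p : MvPolynomial (Fin d) ℝ) : Prop :=
  p.totalDegree ≤ m ∧
    ∀ p' : MvPolynomial (Fin d) ℝ, p'.totalDegree ≤ m → fitCost X θ ψ q e p ≤ fitCost X θ ψ q e p'

end MMLS

/-! The tangent space at `r`, tilted by at most `h²` to make the pair admissible, is a competitor in
the minimization of `J`. A `C²` manifold leaves its tangent spaces quadratically, so the minimum is
`O(h⁴)` (`IsLocalCoord.cost_le`). Since `θ ≥ c₃` up to distance `c₂ h ≥ 3h`, every sample that close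
to `q` lies within `O(h²)` of `H`.

Fill distance and separation place samples quantitatively in every tangent direction around the
sample `x₀` near `q` (`IsSampleSet.exists_in_direction`). A convexity argument turns this into an
angle `O(h)` between `H` and the tangent space at `x₀` (`IsSampleSet.norm_perp_le_of_near`). Hence
`r - q` is almost normal to the manifold at `x₀`. The search radius is half the reach, and Federer's
inequality then excludes that `r` lies on a remote sheet, leaving `‖r - x₀‖ ≤ 4h`
(`norm_sub_le_of_reach`).

Around `r` and `x₀` the manifold is now a graph over the direction of `H`. The inverse function
theorem with parameters, and compactness of the set of pairs (base point, projection), make the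
radius of the graph and the Taylor constant of `ψ` uniform (`exists_graph`,
`exists_polynomial_approx`). This yields a polynomial `P` with `P(0) = ψ(r)` and residuals
`O(h^(m+1))`.

A least-squares minimizer has residuals of the same order wherever the weight is at least `c₃`, so
its difference from `P` is small at those samples. It is then small at the origin: for `m ≤ 1`
because the samples around `x₀` meet every direction, in general because sufficiently dense sets are
norming for polynomials of bounded degree (`exists_norming`). The same stability gives uniqueness
(`IsWeight.fit_of_stable`). -/

namespace MMLS

/-! ### Orthogonal coordinates, tilting of subspaces, operator bounds from spread vectors. -/

section LinearAlgebra

variable {E : Type*} [NormedAddCommGroup E] [InnerProductSpace ℝ E] [FiniteDimensional ℝ E]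
  {d : ℕ}

theorem norm_inv_smul_self {E : Type*} [NormedAddCommGroup E] [NormedSpace ℝ E] {x : E} (hx : x ≠ 0) : ‖(‖x‖)⁻¹ • x‖ = 1 := by
  rw [norm_smul, norm_inv, norm_norm, inv_mul_cancel₀ (norm_ne_zero_iff.2 hx)]

/-- The coordinates, in an orthonormal basis `e` of `W`, of the orthogonal projection onto `W`. -/
noncomputable def coords {W : Submodule ℝ E} (e : OrthonormalBasis (Fin d) ℝ W) :
    E →L[ℝ] EuclideanSpace ℝ (Fin d) :=
  (e.repr.toContinuousLinearEquiv : W →L[ℝ] EuclideanSpace ℝ (Fin d)).comp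
    W.orthogonalProjectionOnto

variable {W : Submodule ℝ E} (e : OrthonormalBasis (Fin d) ℝ W)

theorem coords_apply (z : E) (j : Fin d) : coords e z j = inner ℝ (e j : E) z := by
  simp only [coords, ContinuousLinearMap.comp_apply, ContinuousLinearEquiv.coe_coe,
    LinearIsometryEquiv.coe_toContinuousLinearEquiv, OrthonormalBasis.repr_apply_apply]
  rw [← Submodule.inner_orthogonalProjectionOnto_eq_of_mem_left]

theorem norm_coords (z : E) : ‖coords e z‖ = ‖W.starProjection z‖ := by
  simp [coords]

theorem norm_coords_le (z : E) : ‖coords e z‖ ≤ ‖z‖ := by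
  rw [norm_coords]
  exact Submodule.norm_starProjection_apply_le W z

theorem norm_coords_op_le : ‖coords e‖ ≤ 1 :=
  ContinuousLinearMap.opNorm_le_bound _ zero_le_one fun z => by
    simpa using norm_coords_le e z

theorem norm_sq_eq_coords (z : E) : ‖z‖ ^ 2 = ‖coords e z‖ ^ 2 + ‖Wᗮ.starProjection z‖ ^ 2 := by
  rw [norm_coords]
  exact Submodule.norm_sq_eq_add_norm_sq_starProjection z W

/-- Polarization of `norm_sq_eq_coords`. -/
theorem inner_eq_coords (y z : E) :
    inner ℝ y z = inner ℝ (coords e y) (coords e z) +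
      inner ℝ (Wᗮ.starProjection y) (Wᗮ.starProjection z) := by
  have hp : ∀ x, ‖x‖ ^ 2 = ‖coords e x‖ ^ 2 + ‖Wᗮ.starProjection x‖ ^ 2 := norm_sq_eq_coords e
  have h1 := hp (y + z)
  have h2 := hp y
  have h3 := hp z
  rw [map_add, map_add] at h1
  rw [@norm_add_sq_real, @norm_add_sq_real, @norm_add_sq_real] at h1
  linarith

theorem coords_eq_zero_of_perp {z : E} (hz : ∀ v ∈ W, inner ℝ v z = 0) : coords e z = 0 := by
  ext j
  rw [coords_apply]
  exact hz _ (e j).2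

theorem norm_le_coords_add (z : E) : ‖z‖ ≤ ‖coords e z‖ + ‖Wᗮ.starProjection z‖ := by
  rw [norm_coords]
  calc ‖z‖ = ‖W.starProjection z + Wᗮ.starProjection z‖ := by
        rw [Submodule.starProjection_add_starProjection_orthogonal]
    _ ≤ _ := norm_add_le _ _

theorem norm_perp_le (W : Submodule ℝ E) (z : E) : ‖Wᗮ.starProjection z‖ ≤ ‖z‖ :=
  Submodule.norm_starProjection_apply_le _ z

theorem norm_perp_le_sub (W : Submodule ℝ E) (z : E) {w : E} (hw : w ∈ W) :
    ‖Wᗮ.starProjection z‖ ≤ ‖z - w‖ := by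
  have : Wᗮ.starProjection z = Wᗮ.starProjection (z - w) := by
    rw [map_sub, Submodule.starProjection_orthogonal_apply_eq_zero hw, sub_zero]
  rw [this]
  exact norm_perp_le W _

theorem starProjection_sub_perp (W : Submodule ℝ E) (z : E) :
    z - Wᗮ.starProjection z = W.starProjection z := by
  rw [sub_eq_iff_eq_add, Submodule.starProjection_add_starProjection_orthogonal]

/-- The distance to an affine subspace is the norm of the orthogonal component. -/
theorem norm_perp_le_infDist {H : AffineSubspace ℝ E} {q : E} (hq : q ∈ H) (x : E) :
    ‖H.directionᗮ.starProjection (x - q)‖ ≤ Metric.infDist x (H : Set E) := by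
  refine (Metric.le_infDist ⟨q, hq⟩).2 fun y hy => ?_
  rw [dist_eq_norm, show x - y = (x - q) - (y - q) by abel]
  exact norm_perp_le_sub _ _ (H.vsub_mem_direction hy hq)

/-- A subspace can be tilted slightly so that a given vector `z` has a positive component along some
small vector orthogonal to the tilted subspace. -/
theorem exists_tilt (T : Submodule ℝ E) (hT : T ≠ ⊤) {z : E} (hz : z ≠ 0) {ε : ℝ} (hε : 0 < ε) :
    ∃ (W' : Submodule ℝ E) (w : E), Module.finrank ℝ W' = Module.finrank ℝ T ∧
      (∀ v ∈ W', inner ℝ v w = 0) ∧ ‖w‖ ≤ ε ∧ ‖z - w‖ < ‖z‖ ∧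
      ∀ t ∈ T, ∃ t' ∈ W', ‖t - t'‖ ≤ ε * ‖t‖ := by
  -- Subtracting a small multiple of a vector at an acute angle to `z` shortens `z`; the second cap
  -- on `s` gives `s ‖a‖² ≤ ⟪z, a⟫ < 2 ⟪z, a⟫`.
  have key : ∀ a : E, 0 < inner ℝ z a → ∃ s : ℝ, ‖s • a‖ ≤ ε ∧ ‖z - s • a‖ < ‖z‖ := by
    intro a ha
    have ha0 : a ≠ 0 := by rintro rfl; simp at ha
    have hna : 0 < ‖a‖ := norm_pos_iff.2 ha0
    set s := min (ε / ‖a‖) (inner ℝ z a / ‖a‖ ^ 2) with hs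
    have hs0 : 0 < s := by positivity
    have hs1 : s ≤ ε / ‖a‖ := min_le_left _ _
    have hs2 : s ≤ inner ℝ z a / ‖a‖ ^ 2 := min_le_right _ _
    refine ⟨s, ?_, ?_⟩
    · rw [norm_smul, Real.norm_of_nonneg hs0.le]
      rwa [le_div_iff₀ hna] at hs1
    · rw [le_div_iff₀ (by positivity)] at hs2
      have : ‖z - s • a‖ ^ 2 < ‖z‖ ^ 2 := by
        rw [@norm_sub_sq_real, inner_smul_right, norm_smul, Real.norm_of_nonneg hs0.le]
        nlinarith
      exact lt_of_pow_lt_pow_left₀ 2 (norm_nonneg _) this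
  by_cases hzT : z ∈ T
  · obtain ⟨ν, hν, hν1⟩ : ∃ ν ∈ Tᗮ, ν ≠ 0 := by
      by_contra hcon
      push Not at hcon
      exact hT ((Submodule.orthogonal_eq_bot_iff).1 ((Submodule.eq_bot_iff _).2 hcon))
    have hνn : 0 < ‖ν‖ := norm_pos_iff.2 hν1
    have hzn : 0 < ‖z‖ := norm_pos_iff.2 hz
    have hzν : inner ℝ z ν = 0 := (Submodule.mem_orthogonal _ _).1 hν z hzT
    have hνz : inner ℝ ν z = 0 := by rw [real_inner_comm]; exact hzν
    -- As `z` lies in `T`, the space itself must turn: shear it towards a normal `ν`, with `c` such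
    -- that `t` moves by at most `ε ‖t‖`.
    set c := ε / (‖ν‖ * ‖z‖) with hc
    have hc0 : 0 < c := by positivity
    let A : E →ₗ[ℝ] E := LinearMap.id - c • (innerₛₗ ℝ z).smulRight ν
    have hA : ∀ t, A t = t - (c * inner ℝ z t) • ν := fun t => by
      simp [A, smul_smul]
    have hAinj : Function.Injective A := by
      refine (injective_iff_map_eq_zero A).2 fun t ht => ?_
      rw [hA, sub_eq_zero] at ht
      have : inner ℝ z t = 0 := by rw [ht, inner_smul_right, hzν, mul_zero]
      rw [ht, this, mul_zero, zero_smul]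
    -- This vector is orthogonal to the sheared space, since its two cross terms cancel, and it has
    -- the positive product `c ‖ν‖² ‖z‖²` with `z`.
    obtain ⟨s, hs1, hs2⟩ := key (ν + (c * ‖ν‖ ^ 2) • z) (by
      rw [inner_add_right, hzν, inner_smul_right, real_inner_self_eq_norm_sq]; positivity)
    refine ⟨T.map A, s • (ν + (c * ‖ν‖ ^ 2) • z), (T.equivMapOfInjective A hAinj).finrank_eq.symm, ?_, hs1, hs2, ?_⟩
    · rintro v ⟨t, ht, rfl⟩
      have htν : inner ℝ t ν = 0 := (Submodule.mem_orthogonal _ _).1 hν t ht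
      rw [hA, inner_smul_right, inner_add_right, inner_sub_left, inner_sub_left, inner_smul_left,
        inner_smul_left, inner_smul_right, inner_smul_right, htν, hνz, real_inner_self_eq_norm_sq,
        real_inner_comm t z]
      simp
      ring_nf
      simp
    · intro t ht
      refine ⟨A t, ⟨t, ht, rfl⟩, ?_⟩
      rw [hA, sub_sub_cancel, norm_smul, norm_mul, Real.norm_of_nonneg hc0.le]
      have := abs_real_inner_le_norm z t
      rw [Real.norm_eq_abs]
      calc c * |inner ℝ z t| * ‖ν‖ ≤ c * (‖z‖ * ‖t‖) * ‖ν‖ := by gcongr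
        _ = ε * ‖t‖ := by rw [hc]; field_simp
  · have hP : Tᗮ.starProjection z ≠ 0 := by
      rw [Ne, Submodule.starProjection_apply_eq_zero_iff, Submodule.orthogonal_orthogonal]
      exact hzT
    obtain ⟨s, hs1, hs2⟩ := key (Tᗮ.starProjection z) (by
      have h1 := Submodule.starProjection_inner_eq_zero (K := Tᗮ) z (Tᗮ.starProjection z)
        (Submodule.starProjection_apply_mem _ _)
      rw [inner_sub_left, sub_eq_zero, real_inner_self_eq_norm_sq] at h1
      rw [h1]
      have := norm_pos_iff.2 hP
      positivity)
    refine ⟨T, s • Tᗮ.starProjection z, rfl, ?_, hs1, hs2, fun t ht => ⟨t, ht, by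
      simp only [sub_self, norm_zero]; positivity⟩⟩
    intro v hv
    rw [inner_smul_right, (Submodule.mem_orthogonal _ _).1
      (Submodule.starProjection_apply_mem Tᗮ z) v hv, mul_zero]

/-- If the vectors `t` of a family in `T` have small image under `P` and no open half-space misses the
family quantitatively, then `P` is small on `T`. -/
theorem norm_le_of_spread {T : Submodule ℝ E} (P : E →L[ℝ] E) {S : Set E}
    (hS : S.Finite) (hST : S ⊆ T) {a b : ℝ} (ha : 0 < a)
    (hP : ∀ t ∈ S, ‖P t‖ ≤ b) (hspread : ∀ v ∈ T, ‖v‖ = 1 → ∃ t ∈ S, a ≤ inner ℝ v t) :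
    ∀ v ∈ T, ‖P v‖ ≤ b / a * ‖v‖ := by
  -- Otherwise a functional separates `a • v` from the hull; projected to `T` and normalized, it
  -- contradicts the spread in its own direction.
  have hull : ∀ v ∈ T, ‖v‖ = 1 → a • v ∈ convexHull ℝ S := by
    intro v hv hv1
    by_contra hcon
    have hcl : IsClosed (convexHull ℝ S) := hS.isCompact_convexHull ℝ |>.isClosed
    obtain ⟨f, u, hf1, hf2⟩ := geometric_hahn_banach_closed_point (convex_convexHull ℝ S) hcl hcon
    obtain ⟨y, rfl⟩ := (InnerProductSpace.toDual ℝ E).surjective f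
    simp only [InnerProductSpace.toDual_apply_apply] at hf1 hf2
    set y' := T.starProjection y with hy'
    have hin : ∀ t ∈ T, inner ℝ y t = inner ℝ y' t := by
      intro t ht
      have := Submodule.starProjection_inner_eq_zero (K := T) y t ht
      rw [inner_sub_left, sub_eq_zero] at this
      exact this
    have hy'T : y' ∈ T := Submodule.starProjection_apply_mem _ _
    have hSsub : S ⊆ convexHull ℝ S := subset_convexHull ℝ S
    rw [hin _ (T.smul_mem a hv), inner_smul_right] at hf2
    by_cases hy0 : y' = 0
    · obtain ⟨t, htS, ht⟩ := hspread v hv hv1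
      have h1 := hf1 t (hSsub htS)
      rw [hin t (hST htS), hy0] at h1
      rw [hy0] at hf2
      simp only [inner_zero_left, mul_zero] at h1 hf2
      linarith
    · have hn : 0 < ‖y'‖ := norm_pos_iff.2 hy0
      obtain ⟨t, htS, ht⟩ := hspread ((‖y'‖)⁻¹ • y') (T.smul_mem _ hy'T) (norm_inv_smul_self hy0)
      have h1 := hf1 t (hSsub htS)
      rw [hin t (hST htS)] at h1
      rw [inner_smul_left, conj_trivial] at ht
      have h2 : a * ‖y'‖ ≤ inner ℝ y' t := by
        rw [inv_mul_eq_div, le_div_iff₀ hn] at ht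
        exact ht
      have h3 : inner ℝ y' v ≤ ‖y'‖ := by
        have := real_inner_le_norm y' v
        rwa [hv1, mul_one] at this
      nlinarith
  intro v hv
  by_cases hv0 : v = 0
  · simp [hv0]
  have hn : 0 < ‖v‖ := norm_pos_iff.2 hv0
  have hmem := hull ((‖v‖)⁻¹ • v) (T.smul_mem _ hv) (norm_inv_smul_self hv0)
  have hconv : convexHull ℝ S ⊆ P ⁻¹' Metric.closedBall 0 b := by
    refine convexHull_min (fun t ht => ?_) ((convex_closedBall 0 b).linear_preimage P.toLinearMap)
    simpa using hP t ht
  have h1 := hconv hmem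
  simp only [Set.mem_preimage, map_smul, Metric.mem_closedBall, dist_zero_right, norm_smul,
    Real.norm_of_nonneg ha.le, norm_inv, norm_norm] at h1
  rw [← mul_assoc, ← div_eq_mul_inv, div_mul_eq_mul_div, div_le_iff₀ hn] at h1
  rw [div_mul_eq_mul_div, le_div_iff₀ ha]
  linarith

end LinearAlgebra


/-! ### Unique nearest points and Federer's inequality. -/

section Reach

variable {E : Type*} [NormedAddCommGroup E] [InnerProductSpace ℝ E] [FiniteDimensional ℝ E]

/-- The distance to a compact set, minus a smaller multiple of the distance to `z`, is maximal at the
boundary of a ball around `z` as long as nearest points are unique. -/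
theorem exists_le_infDist_of_unique_nearest {A : Set E} (hA : IsCompact A) (hne : A.Nonempty)
    {τ t s : ℝ} (hs0 : 0 ≤ s) (hts : t + s ≤ τ)
    (hτ : ∀ x, Metric.infDist x A ≤ τ → ∀ a ∈ A, ∀ b ∈ A, dist x a = Metric.infDist x A →
      dist x b = Metric.infDist x A → a = b)
    {z : E} (ht : 0 < t) (hz : Metric.infDist z A = t) {η : ℝ} (hη : 0 < η) (hη1 : η < 1) :
    ∃ w ∈ Metric.closedBall z s, t + (1 - η) * s ≤ Metric.infDist w A := by
  set f : E → ℝ := fun w => Metric.infDist w A with hf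
  have hfc : Continuous f := Metric.continuous_infDist_pt A
  have hfz : f z ≤ t := hz.le
  have hnear : t ≤ f z := hz.ge
  have hB : IsCompact (Metric.closedBall z s) := isCompact_closedBall z s
  have hBne : (Metric.closedBall z s).Nonempty := ⟨z, Metric.mem_closedBall_self hs0⟩
  -- Where the nearest point is unique, the distance grows with slope one away from it, which beats
  -- the penalty of slope `1 - η`; so the maximum cannot be interior.
  obtain ⟨w, hwB, hwmax⟩ := hB.exists_isMaxOn hBne
    (f := fun w => f w - (1 - η) * dist w z) (by fun_prop)
  refine ⟨w, hwB, ?_⟩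
  have hgz : f z ≤ f w - (1 - η) * dist w z := by
    have := hwmax (Metric.mem_closedBall_self hs0)
    simpa using this
  have hwz : dist w z ≤ s := hwB
  suffices dist w z = s by
    rw [this] at hgz
    have : t ≤ f z := hnear
    linarith
  by_contra hwne
  have hlt : dist w z < s := lt_of_le_of_ne hwz hwne
  set δ := f w with hδ
  have hδ0 : 0 < δ := by
    have : t ≤ f z := hnear
    have : 0 ≤ (1 - η) * dist w z := mul_nonneg (by linarith) dist_nonneg
    linarith
  have hδτ : δ ≤ τ := by
    have : f w ≤ f z + dist w z := Metric.infDist_le_infDist_add_dist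
    linarith
  obtain ⟨a, haA, ha⟩ := hA.exists_infDist_eq_dist hne w
  have ha' : dist w a = δ := ha.symm
  -- Uniqueness and compactness: almost nearest points of `w` are close to `a`.
  obtain ⟨γ, hγ0, hγ⟩ : ∃ γ > 0, ∀ b ∈ A, dist w b < δ + γ → dist b a < δ * η / 2 := by
    have hcl : IsCompact (A \ Metric.ball a (δ * η / 2)) := hA.diff Metric.isOpen_ball
    rcases (A \ Metric.ball a (δ * η / 2)).eq_empty_or_nonempty with hemp | hnemp
    · refine ⟨1, one_pos, fun b hb _ => ?_⟩
      by_contra hcon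
      exact (Set.eq_empty_iff_forall_notMem.1 hemp b) ⟨hb, hcon⟩
    · obtain ⟨b, hb, hbmin⟩ := hcl.exists_isMinOn hnemp (f := fun b => dist w b) (by fun_prop)
      have hb1 : δ ≤ dist w b := Metric.infDist_le_dist_of_mem hb.1
      have hb2 : δ ≠ dist w b := by
        intro heq
        have hab := hτ w hδτ a haA b hb.1 ha' heq.symm
        apply hb.2
        rw [← hab]
        exact Metric.mem_ball_self (by positivity)
      refine ⟨dist w b - δ, sub_pos.2 (lt_of_le_of_ne hb1 hb2), fun c hc hcd => ?_⟩
      by_contra hcon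
      have : dist w b ≤ dist w c := hbmin ⟨hc, hcon⟩
      linarith
  -- The step stays in the ball, costs at most `2ε < γ` in near-minimality, and is too short for the
  -- inequality `δ η ≤ ε` reached at the end.
  set ε := min (min (s - dist w z) (γ / 3)) (δ * η / 2) with hε
  have hε0 : 0 < ε := by
    have := sub_pos.2 hlt
    positivity
  have hε1 : ε ≤ s - dist w z := (min_le_left _ _).trans (min_le_left _ _)
  have hε2 : ε ≤ γ / 3 := (min_le_left _ _).trans (min_le_right _ _)
  have hε3 : ε ≤ δ * η / 2 := min_le_right _ _
  set u := δ⁻¹ • (w - a) with hu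
  have hu1 : ‖u‖ = 1 := by
    rw [hu, norm_smul, ← dist_eq_norm, ha', Real.norm_of_nonneg (by positivity),
      inv_mul_cancel₀ hδ0.ne']
  have hdw : dist (w + ε • u) w = ε := by
    rw [dist_eq_norm, add_sub_cancel_left, norm_smul, hu1, mul_one, Real.norm_of_nonneg hε0.le]
  have hmem : w + ε • u ∈ Metric.closedBall z s := by
    rw [Metric.mem_closedBall]
    have := dist_triangle (w + ε • u) w z
    linarith
  have hmaxw : f (w + ε • u) - (1 - η) * dist (w + ε • u) z ≤ δ - (1 - η) * dist w z :=
    hwmax hmem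
  have htri := dist_triangle (w + ε • u) w z
  have hgain : f (w + ε • u) ≤ δ + (1 - η) * ε := by nlinarith
  obtain ⟨b, hbA, hb⟩ := hA.exists_infDist_eq_dist hne (w + ε • u)
  have hfb : f (w + ε • u) = dist (w + ε • u) b := hb
  have hlip : f (w + ε • u) ≤ f w + dist (w + ε • u) w := Metric.infDist_le_infDist_add_dist
  have hba : dist b a < δ * η / 2 := by
    apply hγ b hbA
    have := dist_triangle w (w + ε • u) b
    rw [dist_comm w (w + ε • u)] at this
    linarith
  have hinner : δ * (1 - η / 2) ≤ inner ℝ u (w - b) := by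
    have h1 : inner ℝ u (w - b) = inner ℝ u (w - a) - inner ℝ u (b - a) := by
      rw [← inner_sub_right]; congr 1; abel
    have h2 : inner ℝ u (w - a) = δ := by
      rw [hu, inner_smul_left, real_inner_self_eq_norm_sq, ← dist_eq_norm, ha', conj_trivial]
      field_simp
    have h3 : inner ℝ u (b - a) ≤ dist b a := by
      have := real_inner_le_norm u (b - a)
      rwa [hu1, one_mul, ← dist_eq_norm] at this
    rw [h1, h2]
    linarith
  have hwb : δ ≤ ‖w - b‖ := by
    rw [← dist_eq_norm]
    exact Metric.infDist_le_dist_of_mem hbA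
  have hsq : δ ^ 2 + 2 * ε * (δ * (1 - η / 2)) ≤ f (w + ε • u) ^ 2 := by
    rw [hfb, dist_eq_norm, show w + ε • u - b = (w - b) + ε • u by abel, @norm_add_sq_real,
      inner_smul_right, real_inner_comm]
    have : δ ^ 2 ≤ ‖w - b‖ ^ 2 := by gcongr
    nlinarith [sq_nonneg ‖ε • u‖]
  have hsq2 : f (w + ε • u) ^ 2 ≤ (δ + (1 - η) * ε) ^ 2 := by
    have : 0 ≤ f (w + ε • u) := Metric.infDist_nonneg
    gcongr
  have h1 : δ * η * ε ≤ (1 - η) ^ 2 * ε ^ 2 := by nlinarith only [hsq, hsq2]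
  have h2 : (1 - η) ^ 2 ≤ 1 := by nlinarith only [hη, hη1]
  have h3 : δ * η ≤ ε := by
    have : δ * η * ε ≤ ε * ε := by nlinarith only [sq_nonneg ε, h1, h2]
    exact le_of_mul_le_mul_right this hε0
  linarith [mul_pos hδ0 hη]

/-- If every point at distance at most `τ` from the compact set `A` has a unique nearest point in
`A`, then a point `z` with nearest point `p` can be moved away from `p` up to distance `τ`. -/
theorem le_infDist_of_unique_nearest {A : Set E} (hA : IsCompact A) {τ t : ℝ}
    (hτ : ∀ x, Metric.infDist x A ≤ τ → ∀ a ∈ A, ∀ b ∈ A, dist x a = Metric.infDist x A →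
      dist x b = Metric.infDist x A → a = b)
    {p ν : E} (hp : p ∈ A) (hν : ‖ν‖ = 1) (ht : 0 < t) (htτ : t ≤ τ)
    (hnear : t ≤ Metric.infDist (p + t • ν) A) :
    τ ≤ Metric.infDist (p + τ • ν) A := by
  have hne : A.Nonempty := ⟨p, hp⟩
  set z := p + t • ν with hz
  set s := τ - t with hs
  have hs0 : 0 ≤ s := sub_nonneg.2 htτ
  set f : E → ℝ := fun w => Metric.infDist w A with hf
  have hfc : Continuous f := Metric.continuous_infDist_pt A
  have hfz : f z ≤ t := by
    have := Metric.infDist_le_dist_of_mem (x := z) hp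
    rwa [hz, dist_eq_norm, add_sub_cancel_left, norm_smul, hν, mul_one,
      Real.norm_of_nonneg ht.le] at this
  have hB : IsCompact (Metric.closedBall z s) := isCompact_closedBall z s
  have hBne : (Metric.closedBall z s).Nonempty := ⟨z, Metric.mem_closedBall_self hs0⟩
  have hstep : ∀ η : ℝ, 0 < η → η < 1 → ∃ w ∈ Metric.closedBall z s, t + (1 - η) * s ≤ f w :=
    fun η hη hη1 => exists_le_infDist_of_unique_nearest hA hne hs0 (by rw [hs]; linarith) hτ ht
      (le_antisymm hfz hnear) hη hη1
  obtain ⟨w, hwB, hwmax⟩ := hB.exists_isMaxOn hBne hfc.continuousOn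
  -- Let `η` tend to zero.
  have hw : τ ≤ f w := by
    refine le_of_forall_pos_lt_add fun ε hε => ?_
    set η := min (1 / 2) (ε / (2 * (s + 1))) with hη
    have hη0 : 0 < η := by positivity
    obtain ⟨w', hw'B, hw'⟩ := hstep η hη0 ((min_le_left _ _).trans_lt (by norm_num))
    have h1 : f w' ≤ f w := hwmax hw'B
    have h2 : η * (2 * (s + 1)) ≤ ε := by
      have : η ≤ ε / (2 * (s + 1)) := min_le_right _ _
      rwa [le_div_iff₀ (by positivity)] at this
    nlinarith
  -- Now `w` is at distance at least `t + s` from `p` but within `s` of `z`: equality in the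
  -- triangle inequality forces `w = p + τ • ν`.
  have hwp : τ ≤ ‖t • ν + (w - z)‖ := by
    have : f w ≤ dist w p := Metric.infDist_le_dist_of_mem hp
    rw [dist_eq_norm, show w - p = t • ν + (w - z) by rw [hz]; abel] at this
    linarith
  have hwz : ‖w - z‖ ≤ s := by rw [← dist_eq_norm]; exact hwB
  have hsq : τ ^ 2 ≤ ‖t • ν + (w - z)‖ ^ 2 := by
    have : 0 ≤ τ := ht.le.trans htτ
    gcongr
  rw [@norm_add_sq_real, norm_smul, hν, Real.norm_of_nonneg ht.le, inner_smul_left,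
    conj_trivial] at hsq
  have hwz2 : ‖w - z‖ ^ 2 ≤ s ^ 2 := by gcongr
  have hts : τ = t + s := by rw [hs]; ring
  have hin : s ≤ inner ℝ ν (w - z) := by
    rw [hts] at hsq
    have : t * s ≤ t * inner ℝ ν (w - z) := by nlinarith
    exact le_of_mul_le_mul_left this ht
  have hzero : ‖(w - z) - s • ν‖ ^ 2 ≤ 0 := by
    rw [@norm_sub_sq_real, inner_smul_right, norm_smul, hν, Real.norm_of_nonneg hs0,
      real_inner_comm]
    nlinarith
  have hweq : w = p + τ • ν := by
    have h0 : (w - z) - s • ν = 0 := by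
      rw [← norm_eq_zero]
      exact pow_eq_zero_iff two_ne_zero |>.1 (le_antisymm hzero (sq_nonneg _))
    rw [hts, add_smul, ← add_assoc, ← hz]
    rw [sub_eq_zero] at h0
    rw [← h0]; abel
  rw [← hweq]
  exact hw

/-- Federer's estimate of the deviation of a set of positive reach from its tangent spaces. -/
theorem norm_perp_le_of_unique_nearest {A : Set E} (hA : IsCompact A) {τ : ℝ} (hτ0 : 0 < τ)
    (hτ : ∀ x, Metric.infDist x A ≤ τ → ∀ a ∈ A, ∀ b ∈ A, dist x a = Metric.infDist x A →
      dist x b = Metric.infDist x A → a = b)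
    {p : E} (hp : p ∈ A) {T : Submodule ℝ E} {K : ℝ} (hK0 : 0 < K)
    (hT : ∀ y ∈ A, ‖Tᗮ.starProjection (y - p)‖ ≤ K * ‖y - p‖ ^ 2) {y : E} (hy : y ∈ A) :
    ‖Tᗮ.starProjection (y - p)‖ ≤ ‖y - p‖ ^ 2 / (2 * τ) := by
  set a := Tᗮ.starProjection (y - p) with ha
  by_cases ha0 : a = 0
  · rw [ha0, norm_zero]; positivity
  have hin : ∀ x, inner ℝ ((‖a‖)⁻¹ • a) x = (‖a‖)⁻¹ * inner ℝ a (Tᗮ.starProjection x) := by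
    intro x
    rw [inner_smul_left, conj_trivial]
    congr 1
    rw [ha, ← Submodule.inner_starProjection_left_eq_right]
    simp only [Submodule.starProjection_apply, Submodule.orthogonalProjectionOnto_mem_subspace_eq_self]
  have hn : 0 < ‖a‖ := norm_pos_iff.2 ha0
  set ν := (‖a‖)⁻¹ • a with hν
  have hν1 : ‖ν‖ = 1 := norm_inv_smul_self ha0
  -- For `t ≤ 1 / (2K)` the quadratic bound keeps `p` a nearest point of `p + t • ν`, which starts
  -- the continuation to distance `τ`.
  set t := min τ (1 / (2 * K)) with ht
  have ht0 : 0 < t := by positivity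
  have htK : t * (2 * K) ≤ 1 := by
    have : t ≤ 1 / (2 * K) := min_le_right _ _
    rwa [le_div_iff₀ (by positivity)] at this
  have hexp : ∀ (s : ℝ) (x : E), 0 ≤ s → dist (p + s • ν) x ^ 2 =
      ‖x - p‖ ^ 2 - 2 * s * inner ℝ ν (x - p) + s ^ 2 := by
    intro s x hs
    rw [dist_comm, dist_eq_norm, show x - (p + s • ν) = (x - p) - s • ν by abel, @norm_sub_sq_real,
      inner_smul_right, norm_smul, hν1, Real.norm_of_nonneg hs, real_inner_comm]
    ring
  have hnear : t ≤ Metric.infDist (p + t • ν) A := by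
    refine (Metric.le_infDist ⟨p, hp⟩).2 fun x hx => ?_
    refine le_of_sq_le_sq ?_ dist_nonneg
    rw [hexp t x ht0.le]
    have h1 : inner ℝ ν (x - p) ≤ K * ‖x - p‖ ^ 2 := by
      rw [hin, inv_mul_eq_div, div_le_iff₀ hn, mul_comm]
      calc _ ≤ ‖a‖ * ‖Tᗮ.starProjection (x - p)‖ := real_inner_le_norm _ _
        _ ≤ _ := by gcongr; exact hT x hx
    nlinarith [sq_nonneg ‖x - p‖]
  have hfar := le_infDist_of_unique_nearest hA hτ hp hν1 ht0 (min_le_left _ _) hnear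
  -- The open ball of radius `τ` around `p + τ • ν` misses `A`; expanding the square at `y` is the
  -- claim.
  have h1 : τ ≤ dist (p + τ • ν) y := hfar.trans (Metric.infDist_le_dist_of_mem hy)
  have h2 : τ ^ 2 ≤ dist (p + τ • ν) y ^ 2 := by gcongr
  rw [hexp τ y hτ0.le] at h2
  have h3 : inner ℝ ν (y - p) = ‖a‖ := by
    rw [hin, ← ha, real_inner_self_eq_norm_sq]
    field_simp
  rw [h3] at h2
  rw [le_div_iff₀ (by positivity)]
  linarith

end Reach


/-! ### Tangent spaces and local graphs from flattening diffeomorphisms. -/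

section Submanifold

open Filter Topology

variable {n d k : ℕ} {M : Set (EuclideanSpace ℝ (Fin n))}

theorem fderiv_symm_comp_fderiv {E : Type*} [NormedAddCommGroup E] [NormedSpace ℝ E]
    {Φ : OpenPartialHomeomorph E E} {p : E} (hp : p ∈ Φ.source)
    (h1 : DifferentiableAt ℝ Φ p) (h2 : DifferentiableAt ℝ Φ.symm (Φ p)) (v : E) :
    fderiv ℝ Φ.symm (Φ p) (fderiv ℝ Φ p v) = v := by
  have hc : HasFDerivAt (Φ.symm ∘ Φ) ((fderiv ℝ Φ.symm (Φ p)).comp (fderiv ℝ Φ p)) p :=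
    h2.hasFDerivAt.comp p h1.hasFDerivAt
  have hid : HasFDerivAt (Φ.symm ∘ Φ) (ContinuousLinearMap.id ℝ E) p :=
    (hasFDerivAt_id p).congr_of_eventuallyEq (Φ.eventually_left_inverse hp)
  simpa using congrArg (fun A : E →L[ℝ] E => A v) (hc.unique hid)

theorem fderiv_comp_fderiv_symm {E : Type*} [NormedAddCommGroup E] [NormedSpace ℝ E]
    {Φ : OpenPartialHomeomorph E E} {p : E} (hp : p ∈ Φ.source)
    (h1 : DifferentiableAt ℝ Φ p) (h2 : DifferentiableAt ℝ Φ.symm (Φ p)) (v : E) :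
    fderiv ℝ Φ p (fderiv ℝ Φ.symm (Φ p) v) = v := by
  have h := fderiv_symm_comp_fderiv (Φ := Φ.symm) (p := Φ p) (Φ.map_source hp) h2
    (by rwa [Φ.left_inv hp, Φ.symm_symm]) v
  rwa [Φ.left_inv hp, Φ.symm_symm] at h

/-- Around each point, the manifold is approximated to first order by its tangent spaces. -/
theorem exists_tangent_local (hk : 2 ≤ k) (hM : IsClosedSubmanifold d k M) {p₀ : EuclideanSpace ℝ (Fin n)}
    (hp₀ : p₀ ∈ M) :
    ∃ ε > 0, ∃ K > 0, ∀ p ∈ Metric.ball p₀ ε, ∃ T : Submodule ℝ (EuclideanSpace ℝ (Fin n)),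
      Module.finrank ℝ T = d ∧ ∀ y ∈ M, ∀ y' ∈ M, ‖y - p‖ < ε → ‖y' - p‖ < ε →
        ‖Tᗮ.starProjection (y - y')‖ ≤ K * (‖y - p‖ + ‖y' - p‖) * ‖y - y'‖ := by
  obtain ⟨Φ, W, hpΦ, hΦ, hΦs, hW, hMW⟩ := hM.slice p₀ hp₀
  have hk1 : (k : WithTop ℕ∞) ≠ 0 := by
    have : k ≠ 0 := by omega
    exact_mod_cast this
  have hk2 : ((1 : WithTop ℕ∞) + 1) ≤ k := by
    have : ((2 : ℕ) : WithTop ℕ∞) ≤ k := by exact_mod_cast hk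
    simpa [one_add_one_eq_two] using this
  have hk3 : ((0 : WithTop ℕ∞) + 1) ≤ k := le_trans (by norm_num) hk2
  have hΦat : ∀ p ∈ Φ.source, ContDiffAt ℝ k Φ p := fun p hp =>
    hΦ.contDiffAt (Φ.open_source.mem_nhds hp)
  have hΦsat : ∀ p ∈ Φ.source, ContDiffAt ℝ k Φ.symm (Φ p) := fun p hp =>
    hΦs.contDiffAt (Φ.open_target.mem_nhds (Φ.map_source hp))
  obtain ⟨K₁, t, ht, hlip⟩ := ((hΦat p₀ hpΦ).fderiv_right hk2).exists_lipschitzOnWith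
  have hBcont : ContinuousAt (fun p => fderiv ℝ Φ.symm (Φ p)) p₀ :=
    ContinuousAt.comp (f := Φ) (g := fderiv ℝ Φ.symm)
      ((hΦsat p₀ hpΦ).fderiv_right (m := 0) hk3).continuousAt (hΦat p₀ hpΦ).continuousAt
  set B₀ := ‖fderiv ℝ Φ.symm (Φ p₀)‖ + 1 with hB₀
  have hB : ∀ᶠ p in 𝓝 p₀, ‖fderiv ℝ Φ.symm (Φ p)‖ < B₀ :=
    hBcont.norm.eventually_lt continuousAt_const (by linarith)
  obtain ⟨ε, hε, hball⟩ := Metric.mem_nhds_iff.1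
    (inter_mem (inter_mem ht (Φ.open_source.mem_nhds hpΦ)) hB)
  have hB₀0 : 0 < B₀ := by positivity
  refine ⟨ε / 2, half_pos hε, B₀ * (K₁ + 1), by positivity, fun p hp => ?_⟩
  have hpε : p ∈ Metric.ball p₀ ε := Metric.ball_subset_ball (by linarith) hp
  have hps : p ∈ Φ.source := (hball hpε).1.2
  have hd1 := (hΦat p hps).differentiableAt hk1
  have hd2 := (hΦsat p hps).differentiableAt hk1
  have hinj : Function.Injective (fderiv ℝ Φ.symm (Φ p)) :=
    Function.LeftInverse.injective (fderiv_comp_fderiv_symm hps hd1 hd2)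
  -- Here `p` may lie off `M`; the space is tangent to the sheet through `p` that `Φ` makes parallel
  -- to `W`.
  refine ⟨W.map (fderiv ℝ Φ.symm (Φ p)).toLinearMap,
    (W.equivMapOfInjective _ hinj).finrank_eq.symm.trans hW, ?_⟩
  intro y hy y' hy' hyp hyp'
  set R := max ‖y - p‖ ‖y' - p‖ with hR
  have hsub : Metric.ball p (ε / 2) ⊆ Metric.ball p₀ ε :=
    Metric.ball_subset_ball' (by rw [Metric.mem_ball] at hp; linarith)
  have hyb : y ∈ Metric.ball p (ε / 2) := by rwa [mem_ball_iff_norm]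
  have hyb' : y' ∈ Metric.ball p (ε / 2) := by rwa [mem_ball_iff_norm]
  have hseg : segment ℝ y' y ⊆ Metric.ball p₀ ε :=
    ((convex_ball p (ε / 2)).segment_subset hyb' hyb).trans hsub
  have hsegR : segment ℝ y' y ⊆ Metric.closedBall p R :=
    (convex_closedBall p R).segment_subset (by rw [mem_closedBall_iff_norm]; exact le_max_right _ _)
      (by rw [mem_closedBall_iff_norm]; exact le_max_left _ _)
  have hmv := Convex.norm_image_sub_le_of_norm_fderiv_le' (𝕜 := ℝ) (f := Φ) (φ := fderiv ℝ Φ p)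
    (C := K₁ * R) (s := segment ℝ y' y) (x := y') (y := y)
    (fun x hx => (hΦat x (hball (hseg hx)).1.2).differentiableAt hk1)
    (fun x hx => (hlip.norm_sub_le (hball (hseg hx)).1.1 (hball hpε).1.1).trans (by
      gcongr; rw [← mem_closedBall_iff_norm]; exact hsegR hx))
    (convex_segment y' y) (left_mem_segment ℝ y' y) (right_mem_segment ℝ y' y)
  have hw : Φ y - Φ y' ∈ W := W.sub_mem ((hMW y (hball (hsub hyb)).1.2).1 hy)
    ((hMW y' (hball (hsub hyb')).1.2).1 hy')
  refine (norm_perp_le_sub _ _ (Submodule.mem_map_of_mem hw)).trans ?_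
  have heq : y - y' - (fderiv ℝ Φ.symm (Φ p)).toLinearMap (Φ y - Φ y') =
      - fderiv ℝ Φ.symm (Φ p) (Φ y - Φ y' - fderiv ℝ Φ p (y - y')) := by
    rw [map_sub (fderiv ℝ Φ.symm (Φ p)) (Φ y - Φ y'), fderiv_symm_comp_fderiv hps hd1 hd2]
    simp
  rw [heq, norm_neg]
  have hBp : ‖fderiv ℝ Φ.symm (Φ p)‖ ≤ B₀ := (hball hpε).2.le
  have hR2 : R ≤ ‖y - p‖ + ‖y' - p‖ := max_le (by simp) (by simp)
  calc _ ≤ ‖fderiv ℝ Φ.symm (Φ p)‖ * ‖Φ y - Φ y' - fderiv ℝ Φ p (y - y')‖ :=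
        ContinuousLinearMap.le_opNorm _ _
    _ ≤ B₀ * ((K₁ + 1) * (‖y - p‖ + ‖y' - p‖) * ‖y - y'‖) := by
        refine mul_le_mul hBp (hmv.trans ?_) (norm_nonneg _) hB₀0.le
        gcongr
        linarith
    _ = _ := by ring

/-- The tangent spaces of a compact manifold of class `C²` approximate it uniformly. -/
theorem exists_tangent (hk : 2 ≤ k) (hM : IsClosedSubmanifold d k M) :
    ∃ K > 0, ∀ p ∈ M, ∃ T : Submodule ℝ (EuclideanSpace ℝ (Fin n)),
      Module.finrank ℝ T = d ∧ ∀ y ∈ M, ∀ y' ∈ M,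
        ‖Tᗮ.starProjection (y - y')‖ ≤ K * (‖y - p‖ + ‖y' - p‖) * ‖y - y'‖ := by
  have key : ∃ ε > 0, ∃ K > 0, ∀ p ∈ M, ∃ T : Submodule ℝ (EuclideanSpace ℝ (Fin n)),
      Module.finrank ℝ T = d ∧ ∀ y ∈ M, ∀ y' ∈ M, ‖y - p‖ < ε → ‖y' - p‖ < ε →
        ‖Tᗮ.starProjection (y - y')‖ ≤ K * (‖y - p‖ + ‖y' - p‖) * ‖y - y'‖ := by
    refine hM.isCompact.induction_on (p := fun S => ∃ ε > 0, ∃ K > 0, ∀ p ∈ S,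
      ∃ T : Submodule ℝ (EuclideanSpace ℝ (Fin n)), Module.finrank ℝ T = d ∧
        ∀ y ∈ M, ∀ y' ∈ M, ‖y - p‖ < ε → ‖y' - p‖ < ε →
          ‖Tᗮ.starProjection (y - y')‖ ≤ K * (‖y - p‖ + ‖y' - p‖) * ‖y - y'‖) ?_ ?_ ?_ ?_
    · exact ⟨1, one_pos, 1, one_pos, by simp⟩
    · rintro s t hst ⟨ε, hε, K, hK, h⟩
      exact ⟨ε, hε, K, hK, fun p hp => h p (hst hp)⟩
    · rintro s t ⟨ε, hε, K, hK, h⟩ ⟨ε', hε', K', hK', h'⟩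
      refine ⟨min ε ε', lt_min hε hε', max K K', lt_max_of_lt_left hK, ?_⟩
      rintro p (hp | hp)
      · obtain ⟨T, hT, hTy⟩ := h p hp
        refine ⟨T, hT, fun y hy y' hy' h1 h2 => (hTy y hy y' hy' (h1.trans_le (min_le_left _ _))
          (h2.trans_le (min_le_left _ _))).trans ?_⟩
        gcongr
        exact le_max_left _ _
      · obtain ⟨T, hT, hTy⟩ := h' p hp
        refine ⟨T, hT, fun y hy y' hy' h1 h2 => (hTy y hy y' hy' (h1.trans_le (min_le_right _ _))
          (h2.trans_le (min_le_right _ _))).trans ?_⟩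
        gcongr
        exact le_max_right _ _
    · intro p hp
      obtain ⟨ε, hε, K, hK, h⟩ := exists_tangent_local hk hM hp
      exact ⟨Metric.ball p ε, mem_nhdsWithin_of_mem_nhds (Metric.ball_mem_nhds p hε), ε, hε, K, hK, h⟩
  obtain ⟨ε, hε, K, hK, h⟩ := key
  refine ⟨max K (1 / ε), lt_max_of_lt_left hK, fun p hp => ?_⟩
  obtain ⟨T, hT, hTy⟩ := h p hp
  refine ⟨T, hT, fun y hy y' hy' => ?_⟩
  by_cases hcase : ‖y - p‖ < ε ∧ ‖y' - p‖ < ε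
  · refine (hTy y hy y' hy' hcase.1 hcase.2).trans ?_
    gcongr
    exact le_max_left _ _
  -- For distant points the factor `1 / ε` makes the right-hand side at least `‖y - y'‖`.
  · have h1 : ε ≤ ‖y - p‖ + ‖y' - p‖ := by
      by_contra hcon
      push Not at hcon
      exact hcase ⟨by linarith [norm_nonneg (y' - p)], by linarith [norm_nonneg (y - p)]⟩
    have h2 : 1 ≤ max K (1 / ε) * (‖y - p‖ + ‖y' - p‖) := by
      calc 1 = 1 / ε * ε := by field_simp
        _ ≤ _ := by gcongr; exact le_max_right _ _
    calc _ ≤ ‖y - y'‖ := norm_perp_le _ _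
      _ ≤ _ := le_mul_of_one_le_left (norm_nonneg _) h2

/-- A vector tangent to the manifold inherits the linear lower bounds that hold for secants. -/
theorem norm_le_of_secant_bound {E F : Type*} [NormedAddCommGroup E] [NormedSpace ℝ E]
    [NormedAddCommGroup F] [NormedSpace ℝ F] {M : Set E} {Φ : OpenPartialHomeomorph E E}
    {W : Submodule ℝ E} {p : E} (hp : p ∈ Φ.source)
    (h1 : DifferentiableAt ℝ Φ p) (h2 : DifferentiableAt ℝ Φ.symm (Φ p))
    (hMW : ∀ x ∈ Φ.source, x ∈ M ↔ Φ x ∈ W) (hpM : p ∈ M)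
    {L : E →L[ℝ] F} {r₁ : ℝ} (hr₁ : 0 < r₁)
    (hL : ∀ y ∈ M, ‖y - p‖ < r₁ → ‖y - p‖ ≤ 2 * ‖L (y - p)‖)
    {v : E} (hv : fderiv ℝ Φ p v ∈ W) : ‖v‖ ≤ 2 * ‖L v‖ := by
  set u := fderiv ℝ Φ p v with hu
  -- A curve in `M` with velocity `v` at `p`: the bound passes from its secants to the limit.
  set c : ℝ → E := fun t => Φ.symm (Φ p + t • u) with hc
  have hline : HasDerivAt (fun t : ℝ => Φ p + t • u) u 0 := by
    simpa using ((hasDerivAt_id (0 : ℝ)).smul_const u).const_add (Φ p)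
  have hc0 : c 0 = p := by simp [hc, Φ.left_inv hp]
  have hcd : HasDerivAt c v 0 := by
    have h3 : HasFDerivAt Φ.symm (fderiv ℝ Φ.symm (Φ p)) (Φ p + (0 : ℝ) • u) := by
      simpa using h2.hasFDerivAt
    have h4 := h3.comp_hasDerivAt (0 : ℝ) hline
    rwa [hu, fderiv_symm_comp_fderiv hp h1 h2] at h4
  have hslope := hasDerivAt_iff_tendsto_slope.1 hcd
  have htgt : ∀ᶠ t in 𝓝 (0 : ℝ), Φ p + t • u ∈ Φ.target :=
    hline.continuousAt.eventually_mem (Φ.open_target.mem_nhds (by simpa using Φ.map_source hp))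
  have hclose : ∀ᶠ t in 𝓝 (0 : ℝ), ‖c t - p‖ < r₁ := by
    have := hcd.continuousAt.eventually_mem (Metric.ball_mem_nhds (c 0) hr₁)
    simpa only [hc0, mem_ball_iff_norm] using this
  refine le_of_tendsto_of_tendsto hslope.norm
    (((L.continuous.tendsto v).comp hslope).norm.const_mul 2) ?_
  filter_upwards [mem_nhdsWithin_of_mem_nhds htgt, mem_nhdsWithin_of_mem_nhds hclose] with t ht1 ht2
  have hcM : c t ∈ M := by
    rw [hMW _ (Φ.map_target ht1), Φ.right_inv ht1]
    exact W.add_mem ((hMW p hp).1 hpM) (W.smul_mem _ hv)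
  have := hL _ hcM ht2
  simp only [slope, vsub_eq_sub, sub_zero, hc0, Function.comp_apply, map_smul, norm_smul]
  calc _ ≤ ‖t⁻¹‖ * (2 * ‖L (c t - p)‖) := by gcongr
    _ = _ := by ring

/-- A set that is flattened by a diffeomorphism is, locally around `r₀`, the graph over a space `F` of
the same dimension, jointly in the base point `r` and the projection `L`. -/
theorem exists_graph_of_flattening {E F : Type*} [NormedAddCommGroup E] [InnerProductSpace ℝ E]
    [FiniteDimensional ℝ E] [NormedAddCommGroup F] [NormedSpace ℝ F] [FiniteDimensional ℝ F]
    {M : Set E} (hk : 1 ≤ k) {Φ : OpenPartialHomeomorph E E} {W : Submodule ℝ E} {r₀ : E}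
    (hr₀ : r₀ ∈ M) (hpΦ : r₀ ∈ Φ.source) (hΦ : ContDiffOn ℝ k Φ Φ.source)
    (hΦs : ContDiffOn ℝ k Φ.symm Φ.target) (hW : Module.finrank ℝ W = Module.finrank ℝ F)
    (hMW : ∀ x ∈ Φ.source, x ∈ M ↔ Φ x ∈ W) {L₀ : E →L[ℝ] F} {r₁ : ℝ} (hr₁ : 0 < r₁)
    (hL₀ : ∀ y ∈ M, ‖y - r₀‖ < r₁ → ‖y - r₀‖ ≤ 2 * ‖L₀ (y - r₀)‖) :
    ∃ Y : E × (E →L[ℝ] F) × F → E,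
      ContDiffAt ℝ k Y (r₀, L₀, 0) ∧ Y (r₀, L₀, 0) = r₀ ∧
      (∀ᶠ a in 𝓝 (r₀, L₀, (0 : F)), Y a ∈ M ∧ a.2.1 (Y a - a.1) = a.2.2) ∧
      ∀ᶠ b in 𝓝 (r₀, L₀, r₀), b.2.2 ∈ M → Y (b.1, b.2.1, b.2.1 (b.2.2 - b.1)) = b.2.2 := by
  have hk1 : (k : WithTop ℕ∞) ≠ 0 := by
    have : k ≠ 0 := by omega
    exact_mod_cast this
  have hΦat : ContDiffAt ℝ k Φ r₀ := hΦ.contDiffAt (Φ.open_source.mem_nhds hpΦ)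
  have hΦsat : ContDiffAt ℝ k Φ.symm (Φ r₀) :=
    hΦs.contDiffAt (Φ.open_target.mem_nhds (Φ.map_source hpΦ))
  have hd1 := hΦat.differentiableAt hk1
  have hd2 := hΦsat.differentiableAt hk1
  set π := Wᗮ.orthogonalProjectionOnto with hπ
  have hπ0 : ∀ x, π x = 0 ↔ x ∈ W := by
    intro x
    rw [hπ, ← Submodule.coe_eq_zero, Submodule.coe_orthogonalProjectionOnto_apply,
      Submodule.starProjection_apply_eq_zero_iff, Submodule.orthogonal_orthogonal]
  -- Carrying `r` and `L` along as coordinates makes the local inverse smooth in them too, which is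
  -- what later permits uniformity by compactness.
  let Θ : E × (E →L[ℝ] F) × E → E × (E →L[ℝ] F) × (F × Wᗮ) :=
    fun a => (a.1, a.2.1, (a.2.1 (a.2.2 - a.1), π (Φ a.2.2)))
  set a₀ : E × (E →L[ℝ] F) × E := (r₀, L₀, r₀) with ha₀
  have hΦ3 : ContDiffAt ℝ k (fun a : E × (E →L[ℝ] F) × E => Φ a.2.2) a₀ :=
    ContDiffAt.comp (g := Φ) (f := fun a : E × (E →L[ℝ] F) × E => a.2.2) a₀ hΦat
      (contDiff_snd.comp contDiff_snd).contDiffAt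
  have hΘ : ContDiffAt ℝ k Θ a₀ := by
    have h1 : ContDiffAt ℝ k (fun a : E × (E →L[ℝ] F) × E => a.2.1 (a.2.2 - a.1)) a₀ := by fun_prop
    have h2 : ContDiffAt ℝ k (fun a : E × (E →L[ℝ] F) × E => π (Φ a.2.2)) a₀ :=
      π.contDiff.contDiffAt.comp a₀ hΦ3
    exact contDiff_fst.contDiffAt.prodMk
      ((contDiff_fst.comp contDiff_snd).contDiffAt.prodMk (h1.prodMk h2))
  set D := fderiv ℝ Θ a₀ with hD
  have hDat : HasFDerivAt Θ D a₀ := (hΘ.differentiableAt hk1).hasFDerivAt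
  have hDval : ∀ v, D v = (v.1, v.2.1, (L₀ (v.2.2 - v.1), π (fderiv ℝ Φ r₀ v.2.2))) := by
    have e1 : HasFDerivAt (fun a : E × (E →L[ℝ] F) × E => a.1)
        (ContinuousLinearMap.fst ℝ E ((E →L[ℝ] F) × E)) a₀ := hasFDerivAt_fst
    have e2 : HasFDerivAt (fun a : E × (E →L[ℝ] F) × E => a.2.1)
        ((ContinuousLinearMap.fst ℝ (E →L[ℝ] F) E).comp
          (ContinuousLinearMap.snd ℝ E ((E →L[ℝ] F) × E))) a₀ :=
      hasFDerivAt_fst.comp a₀ hasFDerivAt_snd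
    have e3 : HasFDerivAt (fun a : E × (E →L[ℝ] F) × E => a.2.2)
        ((ContinuousLinearMap.snd ℝ (E →L[ℝ] F) E).comp
          (ContinuousLinearMap.snd ℝ E ((E →L[ℝ] F) × E))) a₀ :=
      hasFDerivAt_snd.comp a₀ hasFDerivAt_snd
    have e4 := e2.clm_apply (e3.sub e1)
    have e5 : HasFDerivAt (fun a : E × (E →L[ℝ] F) × E => π (Φ a.2.2)) _ a₀ :=
      π.hasFDerivAt.comp a₀ (HasFDerivAt.comp (g := Φ) a₀ hd1.hasFDerivAt e3)
    have e6 : HasFDerivAt Θ _ a₀ := e1.prodMk (e2.prodMk (e4.prodMk e5))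
    intro v
    rw [hDat.unique e6]
    simp [ha₀]
  -- A kernel vector has its last component tangent to `M` at `r₀` and annihilated by `L₀`, which
  -- the secant bound excludes.
  have hDinj : Function.Injective D := by
    refine (injective_iff_map_eq_zero D).2 fun v hv => ?_
    rw [hDval] at hv
    simp only [Prod.mk_eq_zero] at hv
    obtain ⟨hv1, hv2, hv3, hv4⟩ := hv
    rw [hv1, sub_zero] at hv3
    have := norm_le_of_secant_bound hpΦ hd1 hd2 hMW hr₀ hr₁ hL₀ ((hπ0 _).1 hv4)
    rw [hv3, norm_zero, mul_zero, norm_le_zero_iff] at this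
    exact Prod.ext hv1 (Prod.ext hv2 this)
  have hfin : Module.finrank ℝ (E × (E →L[ℝ] F) × E) =
      Module.finrank ℝ (E × (E →L[ℝ] F) × (F × Wᗮ)) := by
    have h1 := W.finrank_add_finrank_orthogonal
    simp only [Module.finrank_prod]
    rw [hW] at h1
    omega
  let De : (E × (E →L[ℝ] F) × E) ≃L[ℝ] (E × (E →L[ℝ] F) × (F × Wᗮ)) :=
    (LinearEquiv.ofInjectiveOfFinrankEq D.toLinearMap hDinj hfin).toContinuousLinearEquiv
  have hDe : HasFDerivAt Θ (De : (E × (E →L[ℝ] F) × E) →L[ℝ] (E × (E →L[ℝ] F) × (F × Wᗮ))) a₀ := by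
    convert hDat using 1
    exact ContinuousLinearMap.ext fun v => rfl
  set Ψ := hΘ.localInverse hDe hk1 with hΨ
  have hΨd : ContDiffAt ℝ k Ψ (Θ a₀) := hΘ.to_localInverse hDe hk1
  have hΨa : Ψ (Θ a₀) = a₀ := hΘ.localInverse_apply_image hDe hk1
  have hstrict := hΘ.hasStrictFDerivAt' hDe hk1
  have hright : ∀ᶠ b in 𝓝 (Θ a₀), Θ (Ψ b) = b := hstrict.eventually_right_inverse
  have hleft : ∀ᶠ a in 𝓝 a₀, Ψ (Θ a) = a := hstrict.eventually_left_inverse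
  have hΘa : Θ a₀ = (r₀, L₀, (0, 0)) := by
    simp only [Θ, ha₀, sub_self, map_zero, Prod.mk.injEq, true_and]
    exact (hπ0 _).2 ((hMW _ hpΦ).1 hr₀)
  rw [hΘa] at hΨd hΨa hright
  let ι : E × (E →L[ℝ] F) × F → E × (E →L[ℝ] F) × (F × Wᗮ) := fun a => (a.1, a.2.1, (a.2.2, 0))
  have hι : ContDiff ℝ k ι := by
    refine contDiff_fst.prodMk ((contDiff_fst.comp contDiff_snd).prodMk
      ((contDiff_snd.comp contDiff_snd).prodMk contDiff_const))
  have hΨι : ContDiffAt ℝ k (fun a => Ψ (ι a)) (r₀, L₀, 0) :=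
    ContDiffAt.comp (g := Ψ) (f := ι) (r₀, L₀, 0) hΨd hι.contDiffAt
  refine ⟨fun a => (Ψ (ι a)).2.2, ?_, ?_, ?_, ?_⟩
  · exact (contDiff_snd.comp contDiff_snd).contDiffAt.comp _ hΨι
  · change (Ψ (r₀, L₀, (0, 0))).2.2 = r₀
    rw [hΨa]
  · have hsrc : ∀ᶠ b in 𝓝 ((r₀, L₀, (0, 0)) : E × (E →L[ℝ] F) × (F × Wᗮ)),
        (Ψ b).2.2 ∈ Φ.source := by
      refine (continuous_snd.comp continuous_snd).continuousAt.comp hΨd.continuousAt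
        |>.eventually_mem (Φ.open_source.mem_nhds ?_)
      simp only [Function.comp_apply]
      rw [hΨa]
      exact hpΦ
    have hιc : Tendsto ι (𝓝 (r₀, L₀, 0)) (𝓝 (r₀, L₀, (0, 0))) := hι.continuous.continuousAt
    filter_upwards [hιc.eventually hright, hιc.eventually hsrc] with a ha1 ha2
    simp only [Θ, ι, Prod.mk.injEq] at ha1
    obtain ⟨h1, h2, h3, h4⟩ := ha1
    refine ⟨(hMW _ ha2).2 ((hπ0 _).1 h4), ?_⟩
    rw [h1, h2] at h3
    exact h3
  · have hsrc : ∀ᶠ b in 𝓝 a₀, b.2.2 ∈ Φ.source :=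
      (continuous_snd.comp continuous_snd).continuousAt.eventually_mem (Φ.open_source.mem_nhds hpΦ)
    filter_upwards [hleft, hsrc] with b hb1 hb2 hbM
    have : π (Φ b.2.2) = 0 := (hπ0 _).2 ((hMW _ hb2).1 hbM)
    change (Ψ (b.1, b.2.1, (b.2.1 (b.2.2 - b.1), 0))).2.2 = b.2.2
    rw [← this]
    exact congrArg (fun x => x.2.2) hb1

/-- The manifold is, locally around `r₀`, the graph over a space `F` of the same dimension, jointly in
the base point `r` and the projection `L`. -/
theorem exists_graph_local (hk : 1 ≤ k) (hM : IsClosedSubmanifold d k M)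
    {r₀ : EuclideanSpace ℝ (Fin n)} (hr₀ : r₀ ∈ M)
    {L₀ : EuclideanSpace ℝ (Fin n) →L[ℝ] EuclideanSpace ℝ (Fin d)} {r₁ : ℝ} (hr₁ : 0 < r₁)
    (hL₀ : ∀ y ∈ M, ‖y - r₀‖ < r₁ → ‖y - r₀‖ ≤ 2 * ‖L₀ (y - r₀)‖) :
    ∃ Y : EuclideanSpace ℝ (Fin n) × (EuclideanSpace ℝ (Fin n) →L[ℝ] EuclideanSpace ℝ (Fin d)) ×
        EuclideanSpace ℝ (Fin d) → EuclideanSpace ℝ (Fin n),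
      ContDiffAt ℝ k Y (r₀, L₀, 0) ∧ Y (r₀, L₀, 0) = r₀ ∧
      (∀ᶠ a in 𝓝 (r₀, L₀, (0 : EuclideanSpace ℝ (Fin d))),
        Y a ∈ M ∧ a.2.1 (Y a - a.1) = a.2.2) ∧
      ∀ᶠ b in 𝓝 (r₀, L₀, r₀), b.2.2 ∈ M → Y (b.1, b.2.1, b.2.1 (b.2.2 - b.1)) = b.2.2 := by
  obtain ⟨Φ, W, hpΦ, hΦ, hΦs, hW, hMW⟩ := hM.slice r₀ hr₀
  exact exists_graph_of_flattening hk hr₀ hpΦ hΦ hΦs (by rw [hW, finrank_euclideanSpace_fin]) hMW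
    hr₁ hL₀

end Submanifold


/-! ### Taylor polynomials with a uniform remainder. -/

section Taylor

open Filter Topology

/-- A function that is `C^N` at a point coincides near it with a compactly supported `C^N` function. -/
theorem exists_contDiff_compactSupport {V : Type*} [NormedAddCommGroup V] [NormedSpace ℝ V]
    [FiniteDimensional ℝ V] {N : ℕ} {g : V → ℝ} {a : V} (hg : ContDiffAt ℝ N g a) :
    ∃ G : V → ℝ, ContDiff ℝ N G ∧ HasCompactSupport G ∧ G =ᶠ[𝓝 a] g := by
  have hev : ∀ᶠ y in 𝓝 a, ContDiffAt ℝ N g y := hg.eventually (by simp)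
  obtain ⟨ε, hε, hball⟩ := Metric.mem_nhds_iff.1 hev
  let f : ContDiffBump a := ⟨ε / 4, ε / 2, by positivity, by linarith⟩
  refine ⟨fun y => f y * g y, ?_, ?_, ?_⟩
  · rw [contDiff_iff_contDiffAt]
    intro y
    by_cases hy : y ∈ Metric.ball a ε
    · exact f.contDiffAt.mul (hball hy)
    · have hz : (fun y => f y * g y) =ᶠ[𝓝 y] fun _ => 0 := by
        have hmem : (Metric.closedBall a (ε / 2))ᶜ ∈ 𝓝 y := by
          refine Metric.isClosed_closedBall.isOpen_compl.mem_nhds fun hc => hy ?_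
          rw [Metric.mem_closedBall] at hc
          rw [Metric.mem_ball]
          linarith
        filter_upwards [hmem] with x hx
        have : f x = 0 := f.zero_of_le_dist (by
          rw [Set.mem_compl_iff, Metric.mem_closedBall, not_le] at hx
          exact hx.le)
        rw [this, zero_mul]
      exact contDiffAt_const.congr_of_eventuallyEq hz
  · exact f.hasCompactSupport.mul_right
  · filter_upwards [f.eventuallyEq_one] with y hy
    rw [hy]; simp

/-- Homogeneous forms coming from multilinear maps are polynomials. -/
theorem exists_polynomial_of_multilinear {V : Type*} [NormedAddCommGroup V] [NormedSpace ℝ V]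
    {d k : ℕ} (A : ContinuousMultilinearMap ℝ (fun _ : Fin k => V) ℝ)
    (ι : EuclideanSpace ℝ (Fin d) →L[ℝ] V) :
    ∃ P : MvPolynomial (Fin d) ℝ, P.totalDegree ≤ k ∧
      ∀ x : EuclideanSpace ℝ (Fin d), MvPolynomial.eval x P = A fun _ => ι x := by
  classical
  let b := EuclideanSpace.basisFun (Fin d) ℝ
  refine ⟨∑ r : Fin k → Fin d, MvPolynomial.C (A fun i => ι (b (r i))) *
    ∏ i, MvPolynomial.X (r i), ?_, ?_⟩
  · refine (MvPolynomial.totalDegree_finsetSum _ _).trans (Finset.sup_le fun r _ => ?_)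
    refine (MvPolynomial.totalDegree_mul _ _).trans ?_
    rw [MvPolynomial.totalDegree_C, zero_add]
    refine (MvPolynomial.totalDegree_finsetProd _ _).trans ?_
    simp [MvPolynomial.totalDegree_X]
  · intro x
    have hx : ι x = ∑ j, x j • ι (b j) := by
      conv_lhs => rw [← b.sum_repr x]
      simp [b, map_sum]
    have h1 : (A fun _ => ι x) = ∑ r : Fin k → Fin d, A fun i => x (r i) • ι (b (r i)) := by
      rw [hx]
      exact A.toMultilinearMap.map_sum (fun _ j => x j • ι (b j))
    rw [h1, map_sum]
    refine Finset.sum_congr rfl fun r _ => ?_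
    rw [A.map_smul_univ (fun i => x (r i))]
    simp [mul_comm]

/-- Reduces the multivariate Taylor formula to the one-variable formula along a line. -/
theorem iteratedDeriv_comp_line {V : Type*} [NormedAddCommGroup V] [NormedSpace ℝ V] {N : ℕ}
    {G : V → ℝ} (hG : ContDiff ℝ N G) (a v : V) {k : ℕ} (hk : k ≤ N) (t : ℝ) :
    iteratedDeriv k (fun s : ℝ => G (a + s • v)) t =
      iteratedFDeriv ℝ k G (a + t • v) fun _ => v := by
  have hG' : ContDiff ℝ N fun z => G (a + z) := hG.comp (contDiff_const.add contDiff_id)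
  have h := (ContinuousLinearMap.toSpanSingleton ℝ v).iteratedFDeriv_comp_right hG' t
    (i := k) (by exact_mod_cast hk)
  rw [iteratedDeriv_eq_iteratedFDeriv]
  have hcomp : (fun s : ℝ => G (a + s • v)) =
      (fun z => G (a + z)) ∘ (ContinuousLinearMap.toSpanSingleton ℝ v) := by
    ext s; simp
  rw [hcomp, h, ContinuousMultilinearMap.compContinuousLinearMap_apply]
  rw [iteratedFDeriv_comp_add_left]
  simp

/-- Taylor polynomials along a subspace of a compactly supported function, with a uniform remainder. -/
theorem exists_taylor_polynomial {V : Type*} [NormedAddCommGroup V] [NormedSpace ℝ V]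
    {d m : ℕ} {G : V → ℝ} (hG : ContDiff ℝ (m + 1 : ℕ) G) (hGc : HasCompactSupport G)
    (ι : EuclideanSpace ℝ (Fin d) →L[ℝ] V) :
    ∃ C : ℝ, 0 ≤ C ∧ ∀ a : V, ∃ P : MvPolynomial (Fin d) ℝ, P.totalDegree ≤ m ∧
      MvPolynomial.eval 0 P = G a ∧
      ∀ x : EuclideanSpace ℝ (Fin d),
        |MvPolynomial.eval x P - G (a + ι x)| ≤ C * ‖x‖ ^ (m + 1) := by
  obtain ⟨B, hB⟩ := (hG.continuous_iteratedFDeriv (m := m + 1) (by simp)).bounded_above_of_compact_support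
    (hGc.iteratedFDeriv (m + 1))
  have hB0 : 0 ≤ B := (norm_nonneg _).trans (hB 0)
  refine ⟨B * ‖ι‖ ^ (m + 1), by positivity, fun a => ?_⟩
  choose P hPdeg hP using fun k : ℕ =>
    exists_polynomial_of_multilinear (iteratedFDeriv ℝ k G a) ι
  set Q : MvPolynomial (Fin d) ℝ :=
    ∑ k ∈ Finset.range (m + 1), MvPolynomial.C ((k.factorial : ℝ)⁻¹) * P k with hQ
  have hbound : ∀ x : EuclideanSpace ℝ (Fin d),
      |MvPolynomial.eval x Q - G (a + ι x)| ≤ B * ‖ι‖ ^ (m + 1) * ‖x‖ ^ (m + 1) := by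
    intro x
    set φ : ℝ → ℝ := fun s => G (a + s • ι x) with hφ
    have hφc : ContDiff ℝ (m + 1 : ℕ) φ := hG.comp (contDiff_const.add (contDiff_id.smul contDiff_const))
    obtain ⟨s, -, hs⟩ := taylor_mean_remainder_lagrange_iteratedDeriv (f := φ) (x := 1) (x₀ := 0)
      (n := m) zero_ne_one (by exact_mod_cast hφc.contDiffOn)
    have hpoly : taylorWithinEval φ m (Set.uIcc 0 1) 0 1 = MvPolynomial.eval x Q := by
      rw [taylor_within_apply, hQ, map_sum]
      refine Finset.sum_congr rfl fun k hk => ?_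
      have hkm : k ≤ m + 1 := (Finset.mem_range.1 hk).le
      rw [iteratedDerivWithin_eq_iteratedDeriv (uniqueDiffOn_uIcc zero_ne_one)
        (hφc.contDiffAt.of_le (by exact_mod_cast hkm)) Set.left_mem_uIcc,
        iteratedDeriv_comp_line hG a (ι x) hkm]
      simp [hP]
    rw [hpoly, iteratedDeriv_comp_line hG a (ι x) le_rfl] at hs
    have h1 : φ 1 = G (a + ι x) := by simp [hφ]
    rw [h1] at hs
    rw [abs_sub_comm, hs, sub_zero, one_pow, mul_one, abs_div]
    refine (div_le_self (abs_nonneg _) ?_).trans ?_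
    · rw [Nat.abs_cast]
      exact_mod_cast Nat.one_le_iff_ne_zero.2 (Nat.factorial_ne_zero _)
    · rw [← Real.norm_eq_abs]
      refine (ContinuousMultilinearMap.le_opNorm _ _).trans ?_
      rw [Finset.prod_const, Finset.card_univ, Fintype.card_fin, mul_assoc, ← mul_pow]
      gcongr
      · exact hB _
      · exact ι.le_opNorm x
  refine ⟨Q, ?_, ?_, hbound⟩
  · refine (MvPolynomial.totalDegree_finsetSum _ _).trans (Finset.sup_le fun k hk => ?_)
    refine (MvPolynomial.totalDegree_mul _ _).trans ?_
    rw [MvPolynomial.totalDegree_C, zero_add]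
    exact (hPdeg k).trans (Nat.lt_succ_iff.1 (Finset.mem_range.1 hk))
  -- The remainder bound vanishes at `x = 0`, so it already contains the value there.
  · have h0 := hbound 0
    rw [norm_zero, zero_pow (Nat.succ_ne_zero m), mul_zero, map_zero, add_zero] at h0
    exact sub_eq_zero.1 (abs_eq_zero.1 (le_antisymm h0 (abs_nonneg _)))

end Taylor


/-! ### Uniform graph radius and uniform polynomial approximation. -/

section UniformGraph

open Filter Topology

variable {n d k m : ℕ} {M : Set (EuclideanSpace ℝ (Fin n))}

/-- The pairs of a point `r` of `M` and a contraction `L` that is uniformly injective on the secants of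
`M` from `r` of length less than `r₁`. -/
def graphPairs {E F : Type*} [NormedAddCommGroup E] [NormedSpace ℝ E] [NormedAddCommGroup F]
    [NormedSpace ℝ F] (M : Set E) (r₁ : ℝ) : Set (E × (E →L[ℝ] F)) :=
  {a | a.1 ∈ M ∧ ‖a.2‖ ≤ 1 ∧ ∀ y ∈ M, ‖y - a.1‖ < r₁ → ‖y - a.1‖ ≤ 2 * ‖a.2 (y - a.1)‖}

/-- The secant condition is a closed one because its premise `‖y - a.1‖ < r₁` is strict: its failure
is a closed alternative. -/
theorem isCompact_graphPairs {E F : Type*} [NormedAddCommGroup E] [NormedSpace ℝ E]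
    [FiniteDimensional ℝ E] [NormedAddCommGroup F] [NormedSpace ℝ F] [FiniteDimensional ℝ F]
    {M : Set E} (hM : IsCompact M) (r₁ : ℝ) :
    IsCompact (graphPairs M r₁ : Set (E × (E →L[ℝ] F))) := by
  have : ProperSpace (E →L[ℝ] F) := FiniteDimensional.proper ℝ _
  have hc : IsCompact (M ×ˢ Metric.closedBall (0 : E →L[ℝ] F) 1) :=
    hM.prod (isCompact_closedBall _ _)
  have hcl : IsClosed {a : E × (E →L[ℝ] F) |
      ∀ y ∈ M, ‖y - a.1‖ < r₁ → ‖y - a.1‖ ≤ 2 * ‖a.2 (y - a.1)‖} := by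
    have heq : {a : E × (E →L[ℝ] F) |
        ∀ y ∈ M, ‖y - a.1‖ < r₁ → ‖y - a.1‖ ≤ 2 * ‖a.2 (y - a.1)‖} =
        ⋂ y ∈ M, ({a | r₁ ≤ ‖y - a.1‖} ∪ {a | ‖y - a.1‖ ≤ 2 * ‖a.2 (y - a.1)‖}) := by
      ext a
      simp only [Set.mem_ofPred_eq, Set.mem_iInter, Set.mem_union]
      refine forall₂_congr fun y _ => ?_
      rw [imp_iff_not_or, not_lt]
    rw [heq]
    refine isClosed_biInter fun y _ => IsClosed.union ?_ ?_
    · exact isClosed_le continuous_const (by fun_prop)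
    · exact isClosed_le (by fun_prop) (by fun_prop)
  convert hc.inter_right hcl using 1
  ext a
  simp [graphPairs, and_assoc]

/-- A property of pairs that holds near every point of a compact set with some radius and constant
holds uniformly. -/
theorem exists_uniform_of_local {A : Type*} [TopologicalSpace A] {K : Set A} (hK : IsCompact K)
    {p : ℝ → ℝ → A → Prop}
    (hp : ∀ ε ε' C C' a, ε' ≤ ε → C ≤ C' → p ε C a → p ε' C' a)
    (h : ∀ a ∈ K, ∃ ε > 0, ∃ C, ∀ᶠ b in 𝓝[K] a, p ε C b) :
    ∃ ε > 0, ∃ C ≥ 0, ∀ a ∈ K, p ε C a := by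
  refine hK.induction_on (p := fun S => ∃ ε > 0, ∃ C ≥ 0, ∀ a ∈ S, p ε C a) ?_ ?_ ?_ ?_
  · exact ⟨1, one_pos, 0, le_rfl, by simp⟩
  · rintro s t hst ⟨ε, hε, C, hC, h⟩
    exact ⟨ε, hε, C, hC, fun a ha => h a (hst ha)⟩
  · rintro s t ⟨ε, hε, C, hC, h⟩ ⟨ε', hε', C', hC', h'⟩
    refine ⟨min ε ε', lt_min hε hε', max C C', le_max_of_le_left hC, ?_⟩
    rintro a (ha | ha)
    · exact hp _ _ _ _ _ (min_le_left _ _) (le_max_left _ _) (h a ha)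
    · exact hp _ _ _ _ _ (min_le_right _ _) (le_max_right _ _) (h' a ha)
  · intro a ha
    obtain ⟨ε, hε, C, hC⟩ := h a ha
    exact ⟨_, hC, ε, hε, max C 0, le_max_right _ _,
      fun b hb => hp _ _ _ _ _ le_rfl (le_max_left _ _) hb⟩

/-- The manifold is a graph over a ball of uniform radius around each point. -/
theorem exists_graph (hk : 1 ≤ k) (hM : IsClosedSubmanifold d k M) {r₁ : ℝ} (hr₁ : 0 < r₁) :
    ∃ ε > 0, ∀ a ∈ (graphPairs M r₁ :
        Set (EuclideanSpace ℝ (Fin n) × (EuclideanSpace ℝ (Fin n) →L[ℝ] EuclideanSpace ℝ (Fin d)))),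
      ∃ Y : EuclideanSpace ℝ (Fin d) → EuclideanSpace ℝ (Fin n),
        ContinuousOn Y (Metric.ball 0 ε) ∧ Y 0 = a.1 ∧
        ∀ x ∈ Metric.ball (0 : EuclideanSpace ℝ (Fin d)) ε,
          Y x ∈ M ∧ a.2 (Y x - a.1) = x ∧ ‖Y x - a.1‖ ≤ 2 * ‖x‖ := by
  suffices h : ∃ ε > 0, ∃ C ≥ (0 : ℝ), ∀ a ∈ (graphPairs M r₁ :
      Set (EuclideanSpace ℝ (Fin n) × (EuclideanSpace ℝ (Fin n) →L[ℝ] EuclideanSpace ℝ (Fin d)))),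
      ∃ Y : EuclideanSpace ℝ (Fin d) → EuclideanSpace ℝ (Fin n),
        ContinuousOn Y (Metric.ball 0 ε) ∧ Y 0 = a.1 ∧
        ∀ x ∈ Metric.ball (0 : EuclideanSpace ℝ (Fin d)) ε,
          Y x ∈ M ∧ a.2 (Y x - a.1) = x ∧ ‖Y x - a.1‖ ≤ 2 * ‖x‖ by
    obtain ⟨ε, hε, -, -, h⟩ := h
    exact ⟨ε, hε, h⟩
  refine exists_uniform_of_local (isCompact_graphPairs hM.isCompact r₁)
    (p := fun ε _ (a : EuclideanSpace ℝ (Fin n) ×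
        (EuclideanSpace ℝ (Fin n) →L[ℝ] EuclideanSpace ℝ (Fin d))) =>
      ∃ Y : EuclideanSpace ℝ (Fin d) → EuclideanSpace ℝ (Fin n),
        ContinuousOn Y (Metric.ball 0 ε) ∧ Y 0 = a.1 ∧
        ∀ x ∈ Metric.ball (0 : EuclideanSpace ℝ (Fin d)) ε,
          Y x ∈ M ∧ a.2 (Y x - a.1) = x ∧ ‖Y x - a.1‖ ≤ 2 * ‖x‖) ?_ ?_
  · rintro ε ε' - - a hεε - ⟨Y, hY, hY0, h⟩
    have hsub := Metric.ball_subset_ball (x := (0 : EuclideanSpace ℝ (Fin d))) hεε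
    exact ⟨Y, hY.mono hsub, hY0, fun x hx => h x (hsub hx)⟩
  · rintro ⟨r₀, L₀⟩ ⟨hr₀, -, hL₀⟩
    obtain ⟨Y, hYc, hY0, hYM, -⟩ := exists_graph_local hk hM hr₀ hr₁ hL₀
    have hcont : ∀ᶠ a in 𝓝 (r₀, L₀, (0 : EuclideanSpace ℝ (Fin d))), ContinuousAt Y a :=
      (hYc.eventually (by simp)).mono fun a ha => ha.continuousAt
    have hclose : ∀ᶠ a in 𝓝 (r₀, L₀, (0 : EuclideanSpace ℝ (Fin d))), ‖Y a - a.1‖ < r₁ := by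
      have hc : ContinuousAt (fun a => ‖Y a - a.1‖) (r₀, L₀, (0 : EuclideanSpace ℝ (Fin d))) :=
        (hYc.continuousAt.sub continuous_fst.continuousAt).norm
      refine hc.eventually_lt continuousAt_const ?_
      simpa [hY0] using hr₁
    obtain ⟨ε, hε, hball⟩ := Metric.mem_nhds_iff.1 (hYM.and (hcont.and hclose))
    refine ⟨ε, hε, 0, ?_⟩
    filter_upwards [mem_nhdsWithin_of_mem_nhds (Metric.ball_mem_nhds (r₀, L₀) hε),
      self_mem_nhdsWithin] with a ha haK
    have hmem : ∀ x ∈ Metric.ball (0 : EuclideanSpace ℝ (Fin d)) ε,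
        (a.1, a.2, x) ∈ Metric.ball (r₀, L₀, (0 : EuclideanSpace ℝ (Fin d))) ε := by
      intro x hx
      simp only [Metric.mem_ball, Prod.dist_eq, max_lt_iff] at ha hx ⊢
      exact ⟨ha.1, ha.2, hx⟩
    have hbound : ∀ x ∈ Metric.ball (0 : EuclideanSpace ℝ (Fin d)) ε,
        Y (a.1, a.2, x) ∈ M ∧ a.2 (Y (a.1, a.2, x) - a.1) = x ∧
          ‖Y (a.1, a.2, x) - a.1‖ ≤ 2 * ‖x‖ := by
      intro x hx
      obtain ⟨⟨h1, h2⟩, -, h3⟩ := hball (hmem x hx)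
      have h2' : a.2 (Y (a.1, a.2, x) - a.1) = x := h2
      refine ⟨h1, h2', ?_⟩
      have h4 := haK.2.2 _ h1 h3
      rwa [h2'] at h4
    refine ⟨fun x => Y (a.1, a.2, x), fun x hx => ?_, ?_, hbound⟩
    · have h1 : ContinuousAt Y (a.1, a.2, x) := (hball (hmem x hx)).2.1
      exact (ContinuousAt.comp (g := Y) (f := fun x => (a.1, a.2, x)) h1
        (by fun_prop)).continuousWithinAt
    · have h0 := (hbound 0 (Metric.mem_ball_self hε)).2.2
      rw [norm_zero, mul_zero, norm_le_zero_iff, sub_eq_zero] at h0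
      exact h0

/-- A `C^(m+1)` function on the manifold is approximated to order `m + 1` by polynomials in the
coordinates of a projection, uniformly in the base point and the projection. -/
theorem exists_polynomial_approx (hk : m + 1 ≤ k) (hM : IsClosedSubmanifold d k M)
    {ψ : EuclideanSpace ℝ (Fin n) → ℝ} (hψ : IsCkOn (m + 1) M ψ) {r₁ : ℝ} (hr₁ : 0 < r₁) :
    ∃ ε > 0, ∃ C ≥ 0, ∀ a ∈ (graphPairs M r₁ :
        Set (EuclideanSpace ℝ (Fin n) × (EuclideanSpace ℝ (Fin n) →L[ℝ] EuclideanSpace ℝ (Fin d)))),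
      ∃ P : MvPolynomial (Fin d) ℝ, P.totalDegree ≤ m ∧ MvPolynomial.eval 0 P = ψ a.1 ∧
        ∀ y ∈ M, ‖y - a.1‖ < ε →
          |MvPolynomial.eval (a.2 (y - a.1)) P - ψ y| ≤ C * ‖y - a.1‖ ^ (m + 1) := by
  refine exists_uniform_of_local (isCompact_graphPairs hM.isCompact r₁)
    (p := fun ε C (a : EuclideanSpace ℝ (Fin n) ×
        (EuclideanSpace ℝ (Fin n) →L[ℝ] EuclideanSpace ℝ (Fin d))) =>
      ∃ P : MvPolynomial (Fin d) ℝ, P.totalDegree ≤ m ∧ MvPolynomial.eval 0 P = ψ a.1 ∧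
        ∀ y ∈ M, ‖y - a.1‖ < ε →
          |MvPolynomial.eval (a.2 (y - a.1)) P - ψ y| ≤ C * ‖y - a.1‖ ^ (m + 1)) ?_ ?_
  · rintro ε ε' C C' a hεε hCC ⟨P, hP, hP0, h⟩
    refine ⟨P, hP, hP0, fun y hy hyε => (h y hy (hyε.trans_le hεε)).trans ?_⟩
    gcongr
  · rintro ⟨r₀, L₀⟩ ⟨hr₀, -, hL₀⟩
    obtain ⟨Y, hYc, hY0, -, hYinv⟩ := exists_graph_local (by omega) hM hr₀ hr₁ hL₀
    obtain ⟨f, hf, hfψ⟩ := hψ r₀ hr₀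
    have hg : ContDiffAt ℝ (m + 1 : ℕ) (fun a => f (Y a))
        (r₀, L₀, (0 : EuclideanSpace ℝ (Fin d))) :=
      ContDiffAt.comp (g := f) (f := Y) _ (by rw [hY0]; exact hf)
        (hYc.of_le (by exact_mod_cast hk))
    -- The cutoff bounds the top derivative globally in `(r, L, x)`, so expanding in `x` alone gives
    -- one constant for all nearby `(r, L)`.
    obtain ⟨G, hG, hGc, hGeq⟩ := exists_contDiff_compactSupport hg
    let ι : EuclideanSpace ℝ (Fin d) →L[ℝ] EuclideanSpace ℝ (Fin n) ×
        (EuclideanSpace ℝ (Fin n) →L[ℝ] EuclideanSpace ℝ (Fin d)) × EuclideanSpace ℝ (Fin d) :=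
      (ContinuousLinearMap.inr ℝ _ _).comp (ContinuousLinearMap.inr ℝ _ _)
    obtain ⟨C, hC, hT⟩ := exists_taylor_polynomial hG hGc ι
    have hval : ∀ᶠ b : EuclideanSpace ℝ (Fin n) ×
          (EuclideanSpace ℝ (Fin n) →L[ℝ] EuclideanSpace ℝ (Fin d)) × EuclideanSpace ℝ (Fin n)
        in 𝓝 (r₀, L₀, r₀), b.2.2 ∈ M → G (b.1, b.2.1, b.2.1 (b.2.2 - b.1)) = ψ b.2.2 := by
      have hc : Tendsto (fun b : EuclideanSpace ℝ (Fin n) ×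
          (EuclideanSpace ℝ (Fin n) →L[ℝ] EuclideanSpace ℝ (Fin d)) × EuclideanSpace ℝ (Fin n) =>
          (b.1, b.2.1, b.2.1 (b.2.2 - b.1))) (𝓝 (r₀, L₀, r₀)) (𝓝 (r₀, L₀, 0)) := by
        have : Continuous (fun b : EuclideanSpace ℝ (Fin n) ×
          (EuclideanSpace ℝ (Fin n) →L[ℝ] EuclideanSpace ℝ (Fin d)) × EuclideanSpace ℝ (Fin n) =>
          (b.1, b.2.1, b.2.1 (b.2.2 - b.1))) := by fun_prop
        simpa using this.tendsto (r₀, L₀, r₀)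
      have hs : Tendsto (fun b : EuclideanSpace ℝ (Fin n) ×
          (EuclideanSpace ℝ (Fin n) →L[ℝ] EuclideanSpace ℝ (Fin d)) × EuclideanSpace ℝ (Fin n) =>
          b.2.2) (𝓝 (r₀, L₀, r₀)) (𝓝 r₀) :=
        (continuous_snd.comp continuous_snd).continuousAt
      filter_upwards [hc.eventually hGeq, hYinv,
        hs.eventually (eventually_nhdsWithin_iff.1 hfψ)] with b h1 h2 h3 hbM
      rw [h1, h2 hbM, h3 hbM]
    obtain ⟨ε, hε, hball⟩ := Metric.mem_nhds_iff.1 hval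
    refine ⟨ε / 2, half_pos hε, C, ?_⟩
    filter_upwards [mem_nhdsWithin_of_mem_nhds (Metric.ball_mem_nhds (r₀, L₀) (half_pos hε)),
      self_mem_nhdsWithin] with a ha haK
    have hmem : ∀ y ∈ M, ‖y - a.1‖ < ε / 2 → G (a.1, a.2, a.2 (y - a.1)) = ψ y := by
      intro y hyM hy
      refine hball (show (a.1, a.2, y) ∈ Metric.ball (r₀, L₀, r₀) ε from ?_) hyM
      simp only [Metric.mem_ball, Prod.dist_eq, max_lt_iff] at ha ⊢
      refine ⟨by linarith, by linarith, ?_⟩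
      have := dist_triangle y a.1 r₀
      rw [dist_eq_norm y a.1] at this
      linarith
    obtain ⟨P, hP, hP0, hPx⟩ := hT (a.1, a.2, 0)
    refine ⟨P, hP, ?_, fun y hyM hy => ?_⟩
    · rw [hP0]
      have := hmem a.1 haK.1 (by simpa using hε)
      rwa [sub_self, map_zero] at this
    · have h1 := hPx (a.2 (y - a.1))
      have h2 : ((a.1, a.2, 0) : EuclideanSpace ℝ (Fin n) ×
          (EuclideanSpace ℝ (Fin n) →L[ℝ] EuclideanSpace ℝ (Fin d)) × EuclideanSpace ℝ (Fin d)) +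
          ι (a.2 (y - a.1)) = (a.1, a.2, a.2 (y - a.1)) := by
        simp [ι]
      rw [h2, hmem y hyM hy] at h1
      refine h1.trans ?_
      gcongr
      exact (a.2.le_of_opNorm_le haK.2.1 _).trans_eq (one_mul _)

end UniformGraph


/-! ### Norming sets and weighted polynomial least squares. -/

section Polynomials

variable {d : ℕ}

/-- The homothety of ratio `c` transforms polynomials into polynomials of no larger degree. -/
theorem exists_polynomial_smul (p : MvPolynomial (Fin d) ℝ) (c : ℝ) :
    ∃ p' : MvPolynomial (Fin d) ℝ, p'.totalDegree ≤ p.totalDegree ∧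
      ∀ x : Fin d → ℝ, MvPolynomial.eval x p' = MvPolynomial.eval (c • x) p := by
  refine ⟨∑ s ∈ p.support, MvPolynomial.monomial s (p.coeff s * ∏ i, c ^ s i), ?_, fun x => ?_⟩
  · refine (MvPolynomial.totalDegree_finsetSum _ _).trans (Finset.sup_le fun s hs => ?_)
    exact (MvPolynomial.totalDegree_monomial_le _ _).trans (MvPolynomial.le_totalDegree hs)
  · rw [map_sum, MvPolynomial.eval_eq']
    refine Finset.sum_congr rfl fun s _ => ?_
    rw [MvPolynomial.eval_monomial, Finsupp.prod_fintype _ _ (by simp)]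
    simp only [Pi.smul_apply, smul_eq_mul, mul_pow, Finset.prod_mul_distrib]
    ring

/-- Polynomials of bounded degree are bounded, on the unit ball, by their values on a sufficiently
dense subset. -/
theorem exists_norming_unit (d m : ℕ) : ∃ η : ℝ, 0 < η ∧ η < 1 ∧
    ∀ p : MvPolynomial (Fin d) ℝ, p.totalDegree ≤ m →
    ∀ S : Set (EuclideanSpace ℝ (Fin d)), S ⊆ Metric.closedBall 0 1 →
      (∀ x ∈ Metric.closedBall (0 : EuclideanSpace ℝ (Fin d)) 1, ∃ s ∈ S, dist s x < η) →
    ∀ B : ℝ, (∀ s ∈ S, |MvPolynomial.eval s p| ≤ B) →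
    ∀ x ∈ Metric.closedBall (0 : EuclideanSpace ℝ (Fin d)) 1, |MvPolynomial.eval x p| ≤ 2 * B := by
  set D := Metric.closedBall (0 : EuclideanSpace ℝ (Fin d)) 1 with hD
  have : CompactSpace D := isCompact_iff_compactSpace.1 (isCompact_closedBall _ _)
  have hcont : ∀ p : MvPolynomial (Fin d) ℝ,
      Continuous fun x : D => MvPolynomial.eval (x : EuclideanSpace ℝ (Fin d)) p := fun p =>
    (MvPolynomial.continuous_eval p).comp
      ((PiLp.continuous_ofLp 2 _).comp continuous_subtype_val)
  let T : MvPolynomial.restrictTotalDegree (Fin d) ℝ m →ₗ[ℝ] C(D, ℝ) :=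
    { toFun := fun p => ⟨_, hcont p.1⟩
      map_add' := fun p q => by ext x; simp
      map_smul' := fun c p => by ext x; simp }
  let R := LinearMap.range T
  have hRfin : FiniteDimensional ℝ R := inferInstance
  have : ProperSpace R := FiniteDimensional.proper ℝ R
  have : CompactSpace (Metric.closedBall (0 : R) 1) :=
    isCompact_iff_compactSpace.1 (isCompact_closedBall _ _)
  -- In finite dimension the unit ball for the sup norm is compact, so evaluation is uniformly
  -- continuous in polynomial and point together; `η` is a modulus for `1 / 2`.
  have hev : Continuous fun a : Metric.closedBall (0 : R) 1 × D => (a.1.1 : C(D, ℝ)) a.2 := by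
    fun_prop
  have huc := CompactSpace.uniformContinuous_of_continuous hev
  obtain ⟨η, hη, hηu⟩ := Metric.uniformContinuous_iff.1 huc (1 / 2) (by norm_num)
  refine ⟨min η (1 / 2), by positivity, (min_le_right _ _).trans_lt (by norm_num), ?_⟩
  intro p hp S hSD hS B hB x hx
  set f : C(D, ℝ) := T ⟨p, (MvPolynomial.mem_restrictTotalDegree _ _ _).2 hp⟩ with hf
  have hfx : ∀ x : D, f x = MvPolynomial.eval (x : EuclideanSpace ℝ (Fin d)) p := fun x => rfl
  suffices h : ‖f‖ ≤ 2 * B by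
    have := f.norm_coe_le_norm ⟨x, hx⟩
    rw [hfx, Real.norm_eq_abs] at this
    exact this.trans h
  have h0D : (0 : EuclideanSpace ℝ (Fin d)) ∈ D := Metric.mem_closedBall_self zero_le_one
  have hB0 : 0 ≤ B := by
    obtain ⟨s, hs, -⟩ := hS 0 h0D
    exact (abs_nonneg _).trans (hB s hs)
  by_cases hf0 : f = 0
  · rw [hf0, norm_zero]; positivity
  have hn : 0 < ‖f‖ := norm_pos_iff.2 hf0
  have hgR : (‖f‖)⁻¹ • f ∈ R := R.smul_mem _ ⟨_, rfl⟩
  let g : Metric.closedBall (0 : R) 1 := ⟨⟨(‖f‖)⁻¹ • f, hgR⟩, by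
    rw [mem_closedBall_zero_iff]
    exact (norm_inv_smul_self hf0).le⟩
  have hg : ∀ x, ((g.1 : R) : C(D, ℝ)) x = (‖f‖)⁻¹ * f x := fun x => rfl
  have hne : Nonempty D := ⟨⟨0, h0D⟩⟩
  -- At a nearby point of `S`, more than half of the maximum of `|f|` survives.
  obtain ⟨z, -, hz⟩ := isCompact_univ.exists_isMaxOn (Set.univ_nonempty (α := D))
    (f := fun x => ‖f x‖) (by fun_prop)
  have hzn : ‖f‖ ≤ ‖f z‖ := (ContinuousMap.norm_le _ (norm_nonneg _)).2 fun x => hz (Set.mem_univ x)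
  obtain ⟨s, hsS, hsz⟩ := hS z z.2
  have hclose := hηu (a := (g, (⟨s, hSD hsS⟩ : D))) (b := (g, z)) (by
    rw [Prod.dist_eq, dist_self]
    exact max_lt hη (hsz.trans_le (min_le_left _ _)))
  simp only [hg, Real.dist_eq] at hclose
  rw [← mul_sub, abs_mul, abs_inv, abs_norm, inv_mul_eq_div, div_lt_iff₀ hn] at hclose
  have h1 : |f ⟨s, hSD hsS⟩| ≤ B := hB s hsS
  have h2 : ‖f z‖ ≤ |f ⟨s, hSD hsS⟩ - f z| + |f ⟨s, hSD hsS⟩| := by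
    rw [Real.norm_eq_abs]
    have := abs_sub_abs_le_abs_sub (f z) (f ⟨s, hSD hsS⟩)
    rw [abs_sub_comm] at this
    linarith
  linarith

/-- Scale-invariant form of `exists_norming_unit`. -/
theorem exists_norming (d m : ℕ) : ∃ η : ℝ, 0 < η ∧ η < 1 ∧
    ∀ ρ : ℝ, 0 < ρ → ∀ p : MvPolynomial (Fin d) ℝ, p.totalDegree ≤ m →
    ∀ S : Set (EuclideanSpace ℝ (Fin d)), S ⊆ Metric.closedBall 0 ρ →
      (∀ x ∈ Metric.closedBall (0 : EuclideanSpace ℝ (Fin d)) ρ, ∃ s ∈ S, dist s x < η * ρ) →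
    ∀ B : ℝ, (∀ s ∈ S, |MvPolynomial.eval s p| ≤ B) →
    ∀ x ∈ Metric.closedBall (0 : EuclideanSpace ℝ (Fin d)) ρ, |MvPolynomial.eval x p| ≤ 2 * B := by
  obtain ⟨η, hη, hη1, h⟩ := exists_norming_unit d m
  refine ⟨η, hη, hη1, ?_⟩
  intro ρ hρ p hp S hSρ hS B hB x hx
  obtain ⟨p', hp', hpe⟩ := exists_polynomial_smul p ρ
  have hsc : ∀ y : EuclideanSpace ℝ (Fin d),
      MvPolynomial.eval (ρ⁻¹ • y : EuclideanSpace ℝ (Fin d)) p' = MvPolynomial.eval y p := by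
    intro y
    rw [hpe]
    congr 2
    rw [← WithLp.ofLp_smul, smul_inv_smul₀ hρ.ne']
  have hball : ∀ y ∈ Metric.closedBall (0 : EuclideanSpace ℝ (Fin d)) ρ,
      ρ⁻¹ • y ∈ Metric.closedBall (0 : EuclideanSpace ℝ (Fin d)) 1 := by
    intro y hy
    rw [mem_closedBall_zero_iff] at hy ⊢
    rw [norm_smul, Real.norm_of_nonneg (by positivity), inv_mul_eq_div, div_le_one hρ]
    exact hy
  have key := h p' (hp'.trans hp) ((fun y => ρ⁻¹ • y) '' S)
    (by rintro _ ⟨s, hs, rfl⟩; exact hball s (hSρ hs)) (fun y hy => by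
      obtain ⟨s, hs, hsy⟩ := hS (ρ • y) (by
        rw [mem_closedBall_zero_iff] at hy ⊢
        rw [norm_smul, Real.norm_of_nonneg hρ.le]
        nlinarith)
      refine ⟨_, ⟨s, hs, rfl⟩, ?_⟩
      have : dist (ρ⁻¹ • s) y = ρ⁻¹ * dist s (ρ • y) := by
        conv_lhs => rw [← inv_smul_smul₀ hρ.ne' y]
        rw [dist_smul₀, Real.norm_of_nonneg (by positivity)]
      rw [this, inv_mul_eq_div, div_lt_iff₀ hρ]
      exact hsy) B
    (by rintro _ ⟨s, hs, rfl⟩; simp only [hsc]; exact hB s hs) (ρ⁻¹ • x) (hball x hx)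
  rwa [hsc] at key

/-- The ball contains a product of infinite sets; the divisor `d + 1` avoids a separate case `d =
0`. -/
theorem eq_zero_of_eval_eq_zero_on_ball {p : MvPolynomial (Fin d) ℝ} {ρ : ℝ} (hρ : 0 < ρ)
    (h : ∀ x ∈ Metric.closedBall (0 : EuclideanSpace ℝ (Fin d)) ρ, MvPolynomial.eval x p = 0) :
    p = 0 := by
  refine MvPolynomial.funext_set (fun _ => Set.Icc (0 : ℝ) (ρ / (d + 1)))
    (fun _ => Set.Icc_infinite (by positivity)) fun x hx => ?_
  rw [map_zero]
  refine h (WithLp.toLp 2 x) ?_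
  rw [mem_closedBall_zero_iff]
  have hb : ∀ i, |x i| ≤ ρ / (d + 1) := fun i => by
    have := hx i (Set.mem_univ i)
    rw [abs_of_nonneg this.1]
    exact this.2
  calc ‖WithLp.toLp 2 x‖ = ‖∑ i, x i • EuclideanSpace.basisFun (Fin d) ℝ i‖ := by
        congr 1
        exact ((EuclideanSpace.basisFun (Fin d) ℝ).sum_repr (WithLp.toLp 2 x)).symm
    _ ≤ ∑ i, ‖x i • EuclideanSpace.basisFun (Fin d) ℝ i‖ := norm_sum_le _ _
    _ ≤ ∑ _i : Fin d, ρ / (d + 1) := by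
        refine Finset.sum_le_sum fun i _ => ?_
        rw [norm_smul, OrthonormalBasis.norm_eq_one, mul_one, Real.norm_eq_abs]
        exact hb i
    _ = d * (ρ / (d + 1)) := by simp
    _ ≤ ρ := by
        rw [mul_div_assoc', div_le_iff₀ (by positivity)]
        nlinarith

/-- Polynomials of degree at most one are affine functions. -/
theorem exists_affine {p : MvPolynomial (Fin d) ℝ} (hp : p.totalDegree ≤ 1) :
    ∃ (a : ℝ) (b : EuclideanSpace ℝ (Fin d)), ∀ x : EuclideanSpace ℝ (Fin d),
      MvPolynomial.eval x p = a + inner ℝ b x := by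
  classical
  have hmon : ∀ s ∈ p.support, ∃ (a : ℝ) (b : EuclideanSpace ℝ (Fin d)),
      ∀ x : EuclideanSpace ℝ (Fin d), ∏ i, x i ^ s i = a + inner ℝ b x := by
    intro s hs
    have hsum : ∑ i, s i ≤ 1 := by
      have := (MvPolynomial.le_totalDegree hs).trans hp
      rwa [Finsupp.sum_fintype _ _ (by simp)] at this
    by_cases h0 : ∀ i, s i = 0
    · exact ⟨1, 0, fun x => by simp [h0]⟩
    · push Not at h0
      obtain ⟨j, hj⟩ := h0
      have hother : ∀ i, i ≠ j → s i = 0 := by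
        intro i hij
        have h1 := Finset.add_sum_erase Finset.univ (fun i => s i) (Finset.mem_univ j)
        have h2 := Finset.single_le_sum (f := fun i => s i) (fun _ _ => Nat.zero_le _)
          (Finset.mem_erase.2 ⟨hij, Finset.mem_univ i⟩)
        omega
      have hj1 : s j = 1 := by
        have := Finset.single_le_sum (f := fun i => s i) (fun _ _ => Nat.zero_le _)
          (Finset.mem_univ j)
        omega
      refine ⟨0, EuclideanSpace.basisFun (Fin d) ℝ j, fun x => ?_⟩
      rw [Finset.prod_eq_single j (fun i _ hij => by rw [hother i hij, pow_zero]) (by simp), hj1]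
      rw [← OrthonormalBasis.repr_apply_apply]
      simp
  choose! a b hab using hmon
  refine ⟨∑ s ∈ p.support, p.coeff s * a s, ∑ s ∈ p.support, p.coeff s • b s, fun x => ?_⟩
  rw [MvPolynomial.eval_eq', sum_inner, ← Finset.sum_add_distrib]
  refine Finset.sum_congr rfl fun s hs => ?_
  rw [hab s hs, inner_smul_left]
  simp [mul_add]

variable {α : Type*} (X : Finset α) (w b : α → ℝ) (x : α → Fin d → ℝ)

/-- The weighted least-squares cost of a polynomial. -/
noncomputable def lsCost (p : MvPolynomial (Fin d) ℝ) : ℝ :=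
  ∑ a ∈ X, (MvPolynomial.eval (x a) p - b a) ^ 2 * w a

variable {X w b x}

/-- After scaling by `√w`, the cost is a squared distance to a finite-dimensional subspace,
minimized by orthogonal projection. -/
theorem exists_lsCost_min (hw : ∀ a ∈ X, 0 ≤ w a) (m : ℕ) :
    ∃ p : MvPolynomial (Fin d) ℝ, p.totalDegree ≤ m ∧
      ∀ p' : MvPolynomial (Fin d) ℝ, p'.totalDegree ≤ m → lsCost X w b x p ≤ lsCost X w b x p' := by
  let A : MvPolynomial.restrictTotalDegree (Fin d) ℝ m →ₗ[ℝ] EuclideanSpace ℝ X :=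
    { toFun := fun p => WithLp.toLp 2 fun a => √(w a) * MvPolynomial.eval (x a) p.1
      map_add' := fun p q => by ext a; simp [mul_add]
      map_smul' := fun c p => by ext a; simp [mul_left_comm] }
  let b' : EuclideanSpace ℝ X := WithLp.toLp 2 fun a => √(w a) * b a
  have hcost : ∀ p : MvPolynomial.restrictTotalDegree (Fin d) ℝ m,
      lsCost X w b x p.1 = ‖b' - A p‖ ^ 2 := by
    intro p
    rw [EuclideanSpace.norm_sq_eq, lsCost, ← Finset.sum_coe_sort X]
    refine Finset.sum_congr rfl fun a _ => ?_
    have : (b' - A p) a = √(w a) * (b a - MvPolynomial.eval (x a) p.1) := by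
      simp [b', A, mul_sub]
    rw [this, Real.norm_eq_abs, sq_abs, mul_pow, Real.sq_sqrt (hw a a.2)]
    ring
  obtain ⟨p, hp⟩ : (LinearMap.range A).starProjection b' ∈ LinearMap.range A :=
    Submodule.starProjection_apply_mem _ _
  refine ⟨p.1, (MvPolynomial.mem_restrictTotalDegree _ _ _).1 p.2, fun p' hp' => ?_⟩
  have hp'2 := hcost ⟨p', (MvPolynomial.mem_restrictTotalDegree _ _ _).2 hp'⟩
  simp only at hp'2
  rw [hcost, hp'2, hp, Submodule.starProjection_minimal]
  have hbdd : BddBelow (Set.range fun y : LinearMap.range A => ‖b' - y‖) :=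
    ⟨0, by rintro _ ⟨y, rfl⟩; exact norm_nonneg _⟩
  have := ciInf_le hbdd ⟨A ⟨p', (MvPolynomial.mem_restrictTotalDegree _ _ _).2 hp'⟩, _, rfl⟩
  have h0 : 0 ≤ ⨅ y : LinearMap.range A, ‖b' - y‖ := Real.iInf_nonneg fun _ => norm_nonneg _
  gcongr

/-- By the parallelogram identity, the midpoint of two minimizers would be better unless they agree
at all points of nonzero weight. -/
theorem existsUnique_lsCost_min (hw : ∀ a ∈ X, 0 ≤ w a) {m : ℕ}
    (hinj : ∀ p : MvPolynomial (Fin d) ℝ, p.totalDegree ≤ m →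
      (∀ a ∈ X, w a ≠ 0 → MvPolynomial.eval (x a) p = 0) → p = 0) :
    ∃! p : MvPolynomial (Fin d) ℝ, p.totalDegree ≤ m ∧
      ∀ p' : MvPolynomial (Fin d) ℝ, p'.totalDegree ≤ m → lsCost X w b x p ≤ lsCost X w b x p' := by
  obtain ⟨p, hp, hpmin⟩ := exists_lsCost_min (b := b) (x := x) hw m
  refine ⟨p, ⟨hp, hpmin⟩, ?_⟩
  rintro q ⟨hq, hqmin⟩
  set r : MvPolynomial (Fin d) ℝ := MvPolynomial.C (1 / 2) * (p + q) with hr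
  have hrdeg : r.totalDegree ≤ m := by
    refine (MvPolynomial.totalDegree_mul _ _).trans ?_
    rw [MvPolynomial.totalDegree_C, zero_add]
    exact (MvPolynomial.totalDegree_add _ _).trans (max_le hp hq)
  have hpar : lsCost X w b x r + ∑ a ∈ X, (MvPolynomial.eval (x a) (q - p)) ^ 2 / 4 * w a =
      (lsCost X w b x p + lsCost X w b x q) / 2 := by
    simp only [lsCost]
    rw [← Finset.sum_add_distrib, ← Finset.sum_add_distrib, Finset.sum_div]
    refine Finset.sum_congr rfl fun a _ => ?_
    rw [hr, map_mul, map_add, map_sub, MvPolynomial.eval_C]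
    ring
  have hle : ∑ a ∈ X, (MvPolynomial.eval (x a) (q - p)) ^ 2 / 4 * w a ≤ 0 := by
    have h1 := hpmin r hrdeg
    have h2 := hqmin r hrdeg
    linarith
  have hnn : ∀ a ∈ X, 0 ≤ (MvPolynomial.eval (x a) (q - p)) ^ 2 / 4 * w a := fun a ha =>
    mul_nonneg (by positivity) (hw a ha)
  have hz := (Finset.sum_eq_zero_iff_of_nonneg hnn).1 (le_antisymm hle (Finset.sum_nonneg hnn))
  refine sub_eq_zero.1 (hinj (q - p) ((MvPolynomial.totalDegree_sub _ _).trans (max_le hq hp)) ?_)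
  intro a ha hwa
  have := (mul_eq_zero.1 (hz a ha)).resolve_right hwa
  have h4 : (MvPolynomial.eval (x a) (q - p)) ^ 2 = 0 := by linarith
  exact pow_eq_zero_iff two_ne_zero |>.1 h4

/-- A polynomial that is at least as good as one with residuals at most `η` has small residuals where
the weights are bounded from below. -/
theorem sq_residual_le (hw : ∀ a ∈ X, 0 ≤ w a) {c₃ c₄ η N : ℝ} (hc₄ : ∀ a ∈ X, w a ≤ c₄)
    (hc₄0 : 0 ≤ c₄)
    (hN : ((X.filter fun a => w a ≠ 0).card : ℝ) ≤ N) {p P : MvPolynomial (Fin d) ℝ}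
    (hle : lsCost X w b x p ≤ lsCost X w b x P)
    (hP : ∀ a ∈ X, w a ≠ 0 → |MvPolynomial.eval (x a) P - b a| ≤ η) {a : α} (ha : a ∈ X)
    (hwa : c₃ ≤ w a) : (MvPolynomial.eval (x a) p - b a) ^ 2 * c₃ ≤ N * c₄ * η ^ 2 := by
  have h1 : lsCost X w b x P ≤ N * c₄ * η ^ 2 := by
    calc lsCost X w b x P =
        ∑ a ∈ X.filter fun a => w a ≠ 0, (MvPolynomial.eval (x a) P - b a) ^ 2 * w a := by
          rw [lsCost, Finset.sum_filter_of_ne]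
          intro a _ h hwa
          exact h (by rw [hwa, mul_zero])
      _ ≤ ∑ _a ∈ X.filter fun a => w a ≠ 0, η ^ 2 * c₄ := by
          refine Finset.sum_le_sum fun a ha => ?_
          rw [Finset.mem_filter] at ha
          have := hP a ha.1 ha.2
          refine mul_le_mul ?_ (hc₄ a ha.1) (hw a ha.1) (sq_nonneg _)
          rw [← sq_abs]
          gcongr
      _ = (X.filter fun a => w a ≠ 0).card * (η ^ 2 * c₄) := by
          rw [Finset.sum_const, nsmul_eq_mul]
      _ ≤ N * (η ^ 2 * c₄) := by gcongr
      _ = _ := by ring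
  have h2 : (MvPolynomial.eval (x a) p - b a) ^ 2 * w a ≤ lsCost X w b x p :=
    Finset.single_le_sum (f := fun a => (MvPolynomial.eval (x a) p - b a) ^ 2 * w a)
      (fun a ha => mul_nonneg (sq_nonneg _) (hw a ha)) ha
  have h3 : (MvPolynomial.eval (x a) p - b a) ^ 2 * c₃ ≤
      (MvPolynomial.eval (x a) p - b a) ^ 2 * w a := by gcongr
  linarith

end Polynomials


/-! ### Samples in every direction, the cost of the minimizer, a radius from the reach. -/

section Sampling

variable {n d : ℕ} {M : Set (EuclideanSpace ℝ (Fin n))} {h ρ δ c₁ c₂ c₃ c₄ : ℝ}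
  {X : Finset (EuclideanSpace ℝ (Fin n))} {θ : ℝ → ℝ}

theorem IsSampleSet.exists_dist_le (hX : IsSampleSet d M h ρ δ X) {y : EuclideanSpace ℝ (Fin n)}
    (hy : y ∈ M) : ∃ x ∈ X, dist y x ≤ h := by
  obtain ⟨x, hx, hxy⟩ := X.finite_toSet.isCompact.exists_infDist_eq_dist hX.nonempty y
  exact ⟨x, hx, hxy ▸ hX.fill.1 ⟨y, hy, rfl⟩⟩

theorem IsWeight.le_of_ne_zero (hθ : IsWeight h c₁ c₂ c₃ c₄ θ) {t : ℝ} (ht : 0 ≤ t)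
    (hne : θ t ≠ 0) : t ≤ c₁ * h := by
  have : t ∈ closure {t | 0 ≤ t ∧ θ t ≠ 0} := subset_closure ⟨ht, hne⟩
  rw [hθ.support] at this
  exact this.2

theorem IsWeight.le_upper (hθ : IsWeight h c₁ c₂ c₃ c₄ θ) {t : ℝ} (ht : 0 ≤ t) : θ t ≤ c₄ :=
  (hθ.antitone Set.self_mem_Ici ht ht).trans hθ.upper

theorem IsWeight.lower_le (hθ : IsWeight h c₁ c₂ c₃ c₄ θ) {t : ℝ} (ht : 0 ≤ t)
    (htc : t ≤ c₂ * h) : c₃ ≤ θ t :=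
  hθ.lower.le.trans (hθ.antitone ht (ht.trans htc) htc)

theorem card_weight_ne_zero_le (hX : IsSampleSet d M h ρ δ X) (hθ : IsWeight h c₁ c₂ c₃ c₄ θ)
    (hc₁ : 1 ≤ c₁) (q : EuclideanSpace ℝ (Fin n)) :
    ((X.filter fun x => θ ‖x - q‖ ≠ 0).card : ℝ) ≤ ρ * c₁ ^ d := by
  refine le_trans ?_ (hX.density c₁ hc₁ q)
  rw [← Set.ncard_coe_finset]
  refine Nat.cast_le.2 (Set.ncard_le_ncard ?_ (X.finite_toSet.inter_of_left _))
  intro x hx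
  rw [Finset.coe_filter] at hx
  exact ⟨hx.1, mem_closedBall_iff_norm.2 (hθ.le_of_ne_zero (norm_nonneg _) hx.2)⟩

/-- A point of `M` in a given direction at a distance slightly larger than `h` from the sample point
`x₀` is covered by another sample point, which therefore lies in that direction. -/
theorem IsSampleSet.exists_in_direction (hX : IsSampleSet d M h ρ δ X) (h0 : 0 < h) (hδ : 0 < δ)
    {x₀ : EuclideanSpace ℝ (Fin n)} (hx₀ : x₀ ∈ X) {W : Submodule ℝ (EuclideanSpace ℝ (Fin n))}
    (e : OrthonormalBasis (Fin d) ℝ W) {κ ε h' : ℝ} (hκ0 : 0 ≤ κ) (hκ : κ ^ 2 ≤ δ / 8)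
    (hflat : ∀ y ∈ M, ‖y - x₀‖ ≤ 4 * h → ‖Wᗮ.starProjection (y - x₀)‖ ≤ κ * ‖y - x₀‖)
    {Y : EuclideanSpace ℝ (Fin d) → EuclideanSpace ℝ (Fin n)}
    (hYc : ContinuousOn Y (Metric.ball 0 ε)) (hY0 : Y 0 = x₀)
    (hY : ∀ x ∈ Metric.ball (0 : EuclideanSpace ℝ (Fin d)) ε, Y x ∈ M ∧ coords e (Y x - x₀) = x)
    (hh' : h < h') (hh'2 : h' ≤ 2 * h) (hε : h' < ε)
    {b : EuclideanSpace ℝ (Fin d)} (hb : ‖b‖ = 1) :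
    ∃ x ∈ X, ‖x - x₀‖ ≤ h + h' ∧ δ ^ 2 * h / 8 ≤ inner ℝ b (coords e (x - x₀)) := by
  have h'0 : 0 < h' := h0.trans hh'
  have hmem : ∀ s ∈ Set.Icc 0 h', s • b ∈ Metric.ball (0 : EuclideanSpace ℝ (Fin d)) ε := by
    intro s hs
    rw [mem_ball_zero_iff, norm_smul, hb, mul_one, Real.norm_of_nonneg hs.1]
    exact hs.2.trans_lt hε
  have hcont : ContinuousOn (fun s : ℝ => ‖Y (s • b) - x₀‖) (Set.Icc 0 h') := by
    refine ContinuousOn.norm (ContinuousOn.sub ?_ continuousOn_const)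
    exact hYc.comp (by fun_prop) hmem
  have hend : h' ≤ ‖Y (h' • b) - x₀‖ := by
    have h1 := (hY _ (hmem h' ⟨h'0.le, le_rfl⟩)).2
    have h2 := norm_coords_le e (Y (h' • b) - x₀)
    rwa [h1, norm_smul, hb, mul_one, Real.norm_of_nonneg h'0.le] at h2
  -- The point above the ray at distance exactly `h' > h` from `x₀` cannot be covered by `x₀`
  -- itself.
  obtain ⟨s, hs, hsn⟩ : h' ∈ (fun s : ℝ => ‖Y (s • b) - x₀‖) '' Set.Icc 0 h' :=
    intermediate_value_Icc h'0.le hcont ⟨by simpa [hY0] using h'0.le, hend⟩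
  simp only at hsn
  obtain ⟨hyM, hyx⟩ := hY _ (hmem s hs)
  set u := Y (s • b) - x₀ with hu
  obtain ⟨x, hxX, hxy⟩ := hX.exists_dist_le hyM
  set z := x - x₀ with hz
  have hzu : ‖z - u‖ ≤ h := by
    rw [dist_comm, dist_eq_norm] at hxy
    rwa [hz, hu, sub_sub_sub_cancel_right]
  have hzn : ‖z‖ ≤ h + h' := by
    have : ‖z‖ ≤ ‖z - u‖ + ‖u‖ := by simpa using norm_add_le (z - u) u
    linarith
  have hne : x ≠ x₀ := by
    rintro rfl
    rw [hz, sub_self, zero_sub, norm_neg] at hzu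
    linarith
  have hsep : h * δ ≤ ‖z‖ := by
    have := hX.separation x hxX x₀ hx₀ hne
    rwa [dist_eq_norm] at this
  refine ⟨x, hxX, hzn, ?_⟩
  have hzu2 : ‖z - u‖ ^ 2 ≤ h ^ 2 := by gcongr
  rw [@norm_sub_sq_real, hsn] at hzu2
  -- From `‖z - u‖ ≤ h < h' = ‖u‖`.
  have hin : ‖z‖ ^ 2 / 2 ≤ inner ℝ z u := by nlinarith
  have hz0 : 0 ≤ ‖z‖ := norm_nonneg z
  have hperp : inner ℝ (Wᗮ.starProjection z) (Wᗮ.starProjection u) ≤ ‖z‖ * (δ / 8 * h') := by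
    have h1 := hflat x (hX.subset hxX) (by linarith)
    have h2 := hflat _ hyM (by linarith)
    rw [← hz] at h1
    rw [← hu, hsn] at h2
    calc _ ≤ ‖Wᗮ.starProjection z‖ * ‖Wᗮ.starProjection u‖ := real_inner_le_norm _ _
      _ ≤ (κ * ‖z‖) * (κ * h') := by gcongr
      _ = κ ^ 2 * (‖z‖ * h') := by ring
      _ ≤ δ / 8 * (‖z‖ * h') := by gcongr
      _ = _ := by ring
  rw [inner_eq_coords e, hyx, inner_smul_right, real_inner_comm] at hin
  set g := inner ℝ b (coords e z) with hg
  -- The normal parts contribute at most `δ h ‖z‖ / 4 ≤ ‖z‖² / 4` by separation, leaving at least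
  -- `‖z‖² / 4` for the tangential product.
  have hsg : h ^ 2 * δ ^ 2 / 4 ≤ s * g := by
    have h1 : ‖z‖ * (δ / 8 * h') ≤ ‖z‖ * (δ / 4 * h) := by
      gcongr ‖z‖ * ?_
      nlinarith
    have h2 : (h * δ) * ‖z‖ ≤ ‖z‖ * ‖z‖ := by gcongr
    have h3 : (h * δ) * (h * δ) ≤ (h * δ) * ‖z‖ := by gcongr
    nlinarith
  have hg0 : 0 ≤ g := by
    by_contra hcon
    push Not at hcon
    have : s * g ≤ 0 := mul_nonpos_of_nonneg_of_nonpos hs.1 hcon.le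
    have : 0 < h ^ 2 * δ ^ 2 / 4 := by positivity
    linarith
  have hs2 : s * g ≤ 2 * h * g := by
    gcongr
    exact hs.2.trans hh'2
  have : h * (δ ^ 2 * h / 4) ≤ h * (2 * g) := by linarith
  have := le_of_mul_le_mul_left this h0
  linarith

/-- The minimal cost is of order `h⁴`. -/
theorem IsLocalCoord.cost_le {r q : EuclideanSpace ℝ (Fin n)}
    {H : AffineSubspace ℝ (EuclideanSpace ℝ (Fin n))} (hq : IsLocalCoord d M h X θ r q H)
    (hr : r ∈ M) (h0 : 0 < h) (h1 : h ≤ 1) (hc₁ : 1 ≤ c₁) (hX : IsSampleSet d M h ρ δ X)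
    (hθ : IsWeight h c₁ c₂ c₃ c₄ θ) {T : Submodule ℝ (EuclideanSpace ℝ (Fin n))}
    (hTd : Module.finrank ℝ T = d) {K : ℝ} (hK : 0 ≤ K)
    (hT : ∀ y ∈ M, ‖Tᗮ.starProjection (y - r)‖ ≤ K * ‖y - r‖ ^ 2) :
    J X θ q H ≤ |ρ| * c₁ ^ d * (((K * (c₁ + 1) ^ 2 + 1 + (c₁ + 1)) * h ^ 2) ^ 2 * |c₄|) := by
  -- In codimension zero there is no room to tilt, but the cost is zero.
  by_cases hTtop : T = ⊤
  · have hn : n = d := by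
      rw [← hTd, hTtop, finrank_top, finrank_euclideanSpace_fin]
    have hdir : H.direction = ⊤ := by
      apply Submodule.eq_top_of_finrank_eq
      rw [hq.1.finrank, finrank_euclideanSpace_fin, hn]
    have hJ : J X θ q H = 0 := by
      refine Finset.sum_eq_zero fun x _ => ?_
      have hxH : x ∈ H := by
        have : x -ᵥ q ∈ H.direction := by rw [hdir]; trivial
        simpa using H.vadd_mem_of_mem_direction this hq.1.mem
      rw [Metric.infDist_zero_of_mem hxH]
      ring
    rw [hJ]
    positivity
  have hreach : 0 < reach M / 2 := lt_of_le_of_lt bot_le hq.1.search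
  obtain ⟨ε₀, hε₀, hε₀r⟩ : ∃ ε₀ : ℝ, 0 < ε₀ ∧ ENNReal.ofReal ε₀ < reach M / 2 := by
    obtain ⟨a, ha0, ha⟩ := ENNReal.lt_iff_exists_nnreal_btwn.1 hreach
    exact ⟨a, by exact_mod_cast ha0, by simpa using ha⟩
  obtain ⟨x₁, hx₁, hx₁r⟩ := hX.exists_dist_le hr
  set ε := min (h ^ 2) ε₀ with hε
  have hεpos : 0 < ε := by positivity
  have hεh : ε ≤ h ^ 2 := min_le_left _ _
  -- The nearest sample may be at distance exactly `h` from `r`, while admissibility asks for less;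
  -- a perturbation of size `h²` repairs this without changing the order of the cost.
  obtain ⟨W', w, hW'd, hw, hwε, hzw, htilt⟩ : ∃ (W' : Submodule ℝ (EuclideanSpace ℝ (Fin n)))
      (w : EuclideanSpace ℝ (Fin n)), Module.finrank ℝ W' = Module.finrank ℝ T ∧
      (∀ v ∈ W', inner ℝ v w = 0) ∧ ‖w‖ ≤ ε ∧ ‖x₁ - r - w‖ < h ∧
      ∀ t ∈ T, ∃ t' ∈ W', ‖t - t'‖ ≤ ε * ‖t‖ := by
    by_cases hz : x₁ - r = 0
    · refine ⟨T, 0, rfl, by simp, by simpa using hεpos.le, by simpa [hz] using h0,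
        fun t ht => ⟨t, ht, ?_⟩⟩
      simp only [sub_self, norm_zero]
      positivity
    · obtain ⟨W', w, a1, a2, a3, a4, a5⟩ := exists_tilt T hTtop hz hεpos
      rw [dist_comm, dist_eq_norm] at hx₁r
      exact ⟨W', w, a1, a2, a3, a4.trans_le hx₁r, a5⟩
  have hwh : ‖w‖ ≤ h ^ 2 := hwε.trans hεh
  have hh2 : h ^ 2 ≤ h := by nlinarith
  have hadm : IsAdmissible d M h X r (r + w) (AffineSubspace.mk' (r + w) W') := by
    refine ⟨AffineSubspace.self_mem_mk' _ _, ?_, ?_, ?_, x₁, hx₁, ?_⟩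
    · rw [AffineSubspace.direction_mk', hW'd, hTd]
    · intro v hv
      rw [AffineSubspace.direction_mk'] at hv
      rw [sub_add_cancel_left, inner_neg_right, hw v hv, neg_zero]
    · refine lt_of_le_of_lt ?_ hε₀r
      rw [edist_dist, dist_eq_norm, add_sub_cancel_left]
      exact ENNReal.ofReal_le_ofReal (hwε.trans (min_le_right _ _))
    · rwa [dist_eq_norm, ← sub_sub]
  refine (hq.2 _ _ hadm).trans ?_
  -- Curvature of `M`, shift by `w`, tilt of `T`.
  set B := (K * (c₁ + 1) ^ 2 + 1 + (c₁ + 1)) * h ^ 2 with hB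
  have hdist : ∀ x ∈ X, θ ‖x - (r + w)‖ ≠ 0 →
      Metric.infDist x (AffineSubspace.mk' (r + w) W' : Set (EuclideanSpace ℝ (Fin n))) ≤ B := by
    intro x hx hxθ
    have hxq := hθ.le_of_ne_zero (norm_nonneg _) hxθ
    have hxr : ‖x - r‖ ≤ (c₁ + 1) * h := by
      have : ‖x - r‖ ≤ ‖x - (r + w)‖ + ‖w‖ := by
        have := norm_add_le (x - (r + w)) w
        rwa [show x - (r + w) + w = x - r by abel] at this
      nlinarith
    set t := T.starProjection (x - r) with ht
    obtain ⟨t', ht', htt'⟩ := htilt t (Submodule.starProjection_apply_mem _ _)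
    have hmem : r + w + t' ∈ AffineSubspace.mk' (r + w) W' := by
      rw [AffineSubspace.mem_mk', vsub_eq_sub, add_sub_cancel_left]
      exact ht'
    refine (Metric.infDist_le_dist_of_mem hmem).trans ?_
    have hdec : x - (r + w + t') = Tᗮ.starProjection (x - r) - w + (t - t') := by
      have := Submodule.starProjection_add_starProjection_orthogonal (K := T) (x - r)
      rw [← ht] at this
      have h2 : Tᗮ.starProjection (x - r) = x - r - t := eq_sub_of_add_eq' this
      rw [h2]; abel
    rw [dist_eq_norm, hdec]
    have e1 : ‖Tᗮ.starProjection (x - r)‖ ≤ K * ((c₁ + 1) * h) ^ 2 :=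
      (hT x (hX.subset hx)).trans (by gcongr)
    have e2 : ‖t - t'‖ ≤ h ^ 2 * (c₁ + 1) := by
      have ht1 : ‖t‖ ≤ (c₁ + 1) * h := (Submodule.norm_starProjection_apply_le _ _).trans hxr
      have ht2 : ‖t‖ ≤ c₁ + 1 := ht1.trans (by nlinarith)
      exact htt'.trans (by gcongr)
    calc _ ≤ ‖Tᗮ.starProjection (x - r)‖ + ‖w‖ + ‖t - t'‖ :=
          (norm_add_le _ _).trans (by gcongr; exact norm_sub_le _ _)
      _ ≤ K * ((c₁ + 1) * h) ^ 2 + h ^ 2 + h ^ 2 * (c₁ + 1) := by gcongr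
      _ = B := by rw [hB]; ring
  have hB0 : 0 ≤ B := by positivity
  calc J X θ (r + w) (AffineSubspace.mk' (r + w) W')
      = ∑ x ∈ X.filter fun x => θ ‖x - (r + w)‖ ≠ 0,
        Metric.infDist x (AffineSubspace.mk' (r + w) W' : Set (EuclideanSpace ℝ (Fin n))) ^ 2 *
          θ ‖x - (r + w)‖ := by
        rw [J, Finset.sum_filter_of_ne]
        intro x _ hne hxθ
        exact hne (by rw [hxθ, mul_zero])
    _ ≤ ∑ _x ∈ X.filter fun x => θ ‖x - (r + w)‖ ≠ 0, B ^ 2 * |c₄| := by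
        refine Finset.sum_le_sum fun x hx => ?_
        rw [Finset.mem_filter] at hx
        refine mul_le_mul ?_ ((hθ.le_upper (norm_nonneg _)).trans (le_abs_self _))
          (hθ.nonneg _ (norm_nonneg _)) (sq_nonneg _)
        have := hdist x hx.1 hx.2
        have := Metric.infDist_nonneg (x := x)
          (s := (AffineSubspace.mk' (r + w) W' : Set (EuclideanSpace ℝ (Fin n))))
        gcongr
    _ = (X.filter fun x => θ ‖x - (r + w)‖ ≠ 0).card * (B ^ 2 * |c₄|) := by
        rw [Finset.sum_const, nsmul_eq_mul]
    _ ≤ |ρ| * c₁ ^ d * (B ^ 2 * |c₄|) := by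
        gcongr
        refine (card_weight_ne_zero_le hX hθ hc₁ _).trans ?_
        gcongr
        exact le_abs_self _

/-- The sample points near `q` are close to the minimizing affine subspace. -/
theorem norm_perp_le_of_cost_le {q : EuclideanSpace ℝ (Fin n)}
    {H : AffineSubspace ℝ (EuclideanSpace ℝ (Fin n))} (hq : q ∈ H) (hc₃ : 0 < c₃)
    (hθ : IsWeight h c₁ c₂ c₃ c₄ θ) {A : ℝ} (hJ : J X θ q H ≤ c₃ * (A * h ^ 2) ^ 2) (hA : 0 ≤ A)
    {x : EuclideanSpace ℝ (Fin n)} (hx : x ∈ X) (hxq : ‖x - q‖ ≤ c₂ * h) :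
    ‖H.directionᗮ.starProjection (x - q)‖ ≤ A * h ^ 2 := by
  refine (norm_perp_le_infDist hq x).trans (le_of_sq_le_sq ?_ (by positivity))
  have h1 : Metric.infDist x (H : Set (EuclideanSpace ℝ (Fin n))) ^ 2 * θ ‖x - q‖ ≤ J X θ q H :=
    Finset.single_le_sum (f := fun x => Metric.infDist x (H : Set (EuclideanSpace ℝ (Fin n))) ^ 2 *
      θ ‖x - q‖) (fun x _ => mul_nonneg (sq_nonneg _) (hθ.nonneg _ (norm_nonneg _))) hx
  have h2 : Metric.infDist x (H : Set (EuclideanSpace ℝ (Fin n))) ^ 2 * c₃ ≤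
      Metric.infDist x (H : Set (EuclideanSpace ℝ (Fin n))) ^ 2 * θ ‖x - q‖ := by
    gcongr
    exact hθ.lower_le (norm_nonneg _) hxq
  have h3 : c₃ * Metric.infDist x (H : Set (EuclideanSpace ℝ (Fin n))) ^ 2 ≤
      c₃ * (A * h ^ 2) ^ 2 := by linarith
  exact le_of_mul_le_mul_left h3 hc₃

/-- The reach may be infinite and need not be attained, so it is capped by a multiple of the
relevant length and shrunk by `3/4`; half of the capped reach is then `2/3` of `τ`. -/
theorem exists_reach_radius (hr : 0 < reach M) (B : ℝ) :
    ∃ τ > 0, (∀ x, Metric.infDist x M ≤ τ → ∀ a ∈ M, ∀ b ∈ M, dist x a = Metric.infDist x M →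
      dist x b = Metric.infDist x M → a = b) ∧
      ∀ s : ℝ, s ≤ B → ENNReal.ofReal s < reach M / 2 → s ≤ 2 / 3 * τ := by
  set R : ℝ≥0∞ := min (reach M) (ENNReal.ofReal (2 * |B| + 1)) with hR
  have hRtop : R ≠ ⊤ := ne_top_of_le_ne_top ENNReal.ofReal_ne_top (min_le_right _ _)
  have hR0 : 0 < R := lt_min hr (by simp; positivity)
  have hRr : 0 < R.toReal := ENNReal.toReal_pos hR0.ne' hRtop
  refine ⟨3 / 4 * R.toReal, by positivity, ?_, ?_⟩
  · have hlt : ENNReal.ofReal (3 / 4 * R.toReal) < reach M := by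
      refine lt_of_lt_of_le ?_ (min_le_left _ _ : R ≤ reach M)
      rw [ENNReal.ofReal_lt_iff_lt_toReal (by positivity) hRtop]
      linarith
    obtain ⟨t, ht, hlt'⟩ := lt_sSup_iff.1 hlt
    intro x hx a ha b hb hxa hxb
    have hne : M.Nonempty := ⟨a, ha⟩
    have hinf : Metric.infEDist x M = ENNReal.ofReal (Metric.infDist x M) := by
      rw [Metric.infDist, ENNReal.ofReal_toReal (Metric.infEDist_ne_top hne)]
    have hxt : Metric.infEDist x M ≤ t := by
      rw [hinf]
      exact (ENNReal.ofReal_le_ofReal hx).trans hlt'.le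
    refine (ht x hxt).unique ⟨ha, ?_⟩ ⟨hb, ?_⟩
    · rw [hinf, edist_dist, hxa]
    · rw [hinf, edist_dist, hxb]
  · intro s hsB hs
    by_cases hs0 : s ≤ 0
    · exact hs0.trans (by positivity)
    push Not at hs0
    have h1 : ENNReal.ofReal (2 * s) ≤ R := by
      refine le_min ?_ (ENNReal.ofReal_le_ofReal ?_)
      · rw [ENNReal.ofReal_mul (by norm_num), mul_comm]
        have := (ENNReal.lt_div_iff_mul_lt (Or.inl two_ne_zero) (Or.inl (by simp))).1 hs
        simpa using this.le
      · have := le_abs_self B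
        linarith
    have h2 := (ENNReal.ofReal_le_iff_le_toReal hRtop).1 h1
    linarith

end Sampling


/-! ### Closeness of the minimizing pair to the tangent bundle. -/

section Geometry

variable {n d k : ℕ} {M : Set (EuclideanSpace ℝ (Fin n))} {h ρ δ c₁ c₂ c₃ c₄ : ℝ}
  {X : Finset (EuclideanSpace ℝ (Fin n))} {θ : ℝ → ℝ}

theorem mem_graphPairs_of_flat {E : Type*} [NormedAddCommGroup E] [InnerProductSpace ℝ E]
    [FiniteDimensional ℝ E] {M : Set E} {p : E} (hp : p ∈ M) {W : Submodule ℝ E}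
    (e : OrthonormalBasis (Fin d) ℝ W) {r₁ : ℝ}
    (hW : ∀ y ∈ M, ‖y - p‖ < r₁ → ‖Wᗮ.starProjection (y - p)‖ ≤ 1 / 2 * ‖y - p‖) :
    (p, coords e) ∈ graphPairs M r₁ := by
  refine ⟨hp, norm_coords_op_le e, fun y hy hyr => ?_⟩
  have h1 := hW y hy hyr
  have h2 := norm_le_coords_add e (y - p)
  simp only
  linarith

/-- If a subspace `W` is close to the sample points near `x₀`, then the tangent space `T` at `x₀` makes
a small angle with `W`. -/
theorem IsSampleSet.norm_perp_le_of_near (hX : IsSampleSet d M h ρ δ X) (h0 : 0 < h) (hδ : 0 < δ)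
    {x₀ q : EuclideanSpace ℝ (Fin n)} (hx₀ : x₀ ∈ X) (hx₀q : dist x₀ q < h)
    {T W : Submodule ℝ (EuclideanSpace ℝ (Fin n))} (e : OrthonormalBasis (Fin d) ℝ T)
    {κ ε K A : ℝ} (hκ0 : 0 ≤ κ) (hκ : κ ^ 2 ≤ δ / 8) (hK : 0 ≤ K)
    (hT : ∀ y ∈ M, ‖Tᗮ.starProjection (y - x₀)‖ ≤ K * ‖y - x₀‖ ^ 2) (hKκ : K * (4 * h) ≤ κ)
    {Y : EuclideanSpace ℝ (Fin d) → EuclideanSpace ℝ (Fin n)}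
    (hYc : ContinuousOn Y (Metric.ball 0 ε)) (hY0 : Y 0 = x₀)
    (hY : ∀ x ∈ Metric.ball (0 : EuclideanSpace ℝ (Fin d)) ε, Y x ∈ M ∧ coords e (Y x - x₀) = x)
    (hε : 2 * h < ε)
    (hW : ∀ x ∈ X, ‖x - q‖ ≤ 3 * h → ‖Wᗮ.starProjection (x - q)‖ ≤ A * h ^ 2) :
    ∀ v ∈ T, ‖Wᗮ.starProjection v‖ ≤ 8 * (2 * A + 9 * K) / δ ^ 2 * h * ‖v‖ := by
  rw [dist_eq_norm] at hx₀q
  -- The strict inequality `‖x₀ - q‖ < h` leaves room for `h' > h` with `h + h' + ‖x₀ - q‖ < 3h`;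
  -- this is why radius `3h` suffices.
  set h' := h + (h - ‖x₀ - q‖) / 2 with hh'
  have hn0 := norm_nonneg (x₀ - q)
  set S : Set (EuclideanSpace ℝ (Fin n)) := (fun x => T.starProjection (x - x₀)) ''
    {x | x ∈ X ∧ ‖x - q‖ ≤ 3 * h ∧ ‖x - x₀‖ ≤ 3 * h} with hS
  have hSfin : S.Finite := (X.finite_toSet.subset fun x hx => hx.1).image _
  have hST : S ⊆ T := by
    rintro _ ⟨x, -, rfl⟩
    exact Submodule.starProjection_apply_mem _ _
  have hflat : ∀ y ∈ M, ‖y - x₀‖ ≤ 4 * h → ‖Tᗮ.starProjection (y - x₀)‖ ≤ κ * ‖y - x₀‖ := by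
    intro y hy hyx
    refine (hT y hy).trans ?_
    have : K * ‖y - x₀‖ ≤ κ := (by gcongr : K * ‖y - x₀‖ ≤ K * (4 * h)).trans hKκ
    nlinarith [norm_nonneg (y - x₀)]
  have hP : ∀ t ∈ S, ‖Wᗮ.starProjection t‖ ≤ (2 * A + 9 * K) * h ^ 2 := by
    rintro _ ⟨x, ⟨hx, hxq, hxx⟩, rfl⟩
    simp only
    rw [← starProjection_sub_perp T (x - x₀), show x - x₀ = (x - q) - (x₀ - q) by abel,
      map_sub Wᗮ.starProjection (x - q - (x₀ - q)), map_sub Wᗮ.starProjection (x - q) (x₀ - q)]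
    have e1 := hW x hx hxq
    have e2 := hW x₀ hx₀ (by linarith)
    have e3 : ‖Wᗮ.starProjection (Tᗮ.starProjection (x - q - (x₀ - q)))‖ ≤ K * (3 * h) ^ 2 := by
      refine (norm_perp_le _ _).trans ?_
      rw [show x - q - (x₀ - q) = x - x₀ by abel]
      refine (hT x (hX.subset hx)).trans ?_
      gcongr
    calc _ ≤ ‖Wᗮ.starProjection (x - q)‖ + ‖Wᗮ.starProjection (x₀ - q)‖ +
          ‖Wᗮ.starProjection (Tᗮ.starProjection (x - q - (x₀ - q)))‖ :=
          (norm_sub_le _ _).trans (add_le_add_left (norm_sub_le _ _) _)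
      _ ≤ A * h ^ 2 + A * h ^ 2 + K * (3 * h) ^ 2 := by gcongr
      _ = _ := by ring
  have hspread : ∀ v ∈ T, ‖v‖ = 1 → ∃ t ∈ S, δ ^ 2 * h / 8 ≤ inner ℝ v t := by
    intro v hv hv1
    have hvT : T.starProjection v = v := Submodule.starProjection_eq_self_iff.2 hv
    obtain ⟨x, hx, hxx, hin⟩ := hX.exists_in_direction h0 hδ hx₀ e hκ0 hκ hflat hYc hY0 hY
      (h' := h') (by rw [hh']; linarith) (by rw [hh']; linarith) (by rw [hh']; linarith)
      (b := coords e v) (by rw [norm_coords, hvT, hv1])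
    refine ⟨_, ⟨x, ⟨hx, ?_, ?_⟩, rfl⟩, ?_⟩
    · have := norm_add_le (x - x₀) (x₀ - q)
      rw [sub_add_sub_cancel] at this
      rw [hh'] at hxx
      linarith
    · rw [hh'] at hxx
      linarith
    · have h1 := inner_eq_coords e v (x - x₀)
      rw [Submodule.starProjection_orthogonal_apply_eq_zero hv, inner_zero_left, add_zero] at h1
      simp only
      rw [← Submodule.inner_starProjection_left_eq_right, hvT, h1]
      exact hin
  intro v hv
  have := norm_le_of_spread (Wᗮ.starProjection) hSfin hST (by positivity) hP hspread v hv
  refine this.trans_eq ?_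
  field_simp

/-- The manifold point `r` projecting to `q` is at distance `O(h)` from the sample point near `q`. -/
theorem norm_sub_le_of_reach {E : Type*} [NormedAddCommGroup E] [InnerProductSpace ℝ E]
    [FiniteDimensional ℝ E] {r q x₀ : E} {T W : Submodule ℝ E} {β τ : ℝ} (hβ : β ≤ 1 / 12)
    (hTW : ∀ v ∈ T, ‖Wᗮ.starProjection v‖ ≤ β * ‖v‖) (hperp : ∀ v ∈ W, inner ℝ v (r - q) = 0)
    (hτ : 0 < τ) (hF : ‖Tᗮ.starProjection (r - x₀)‖ ≤ ‖r - x₀‖ ^ 2 / (2 * τ))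
    (hx₀q : ‖x₀ - q‖ < h) (hrq : ‖r - q‖ ≤ 2 / 3 * τ) (hhτ : h ≤ τ / 6) : ‖r - x₀‖ ≤ 4 * h := by
  set t := T.starProjection (r - q) with ht
  have htT : t ∈ T := Submodule.starProjection_apply_mem _ _
  -- As `r - q` is orthogonal to `W`, it only sees the small component of `t` normal to `W`.
  have ht1 : ‖t‖ * ‖t‖ ≤ β * ‖t‖ * ‖r - q‖ := by
    have h1 : inner ℝ t (r - q) = ‖t‖ * ‖t‖ := by
      have h2 := Submodule.starProjection_inner_eq_zero (K := T) (r - q) t htT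
      rw [inner_sub_left, sub_eq_zero, ← ht, real_inner_self_eq_norm_mul_norm] at h2
      rw [real_inner_comm, h2]
    have h3 : inner ℝ t (r - q) = inner ℝ (Wᗮ.starProjection t) (r - q) := by
      conv_lhs => rw [← Submodule.starProjection_add_starProjection_orthogonal (K := W) t]
      rw [inner_add_left, hperp _ (Submodule.starProjection_apply_mem _ _), zero_add]
    rw [← h1, h3]
    refine (real_inner_le_norm _ _).trans ?_
    gcongr
    exact hTW t htT
  have ht2 : ‖t‖ ≤ 1 / 12 * ‖r - q‖ := by
    by_cases ht0 : ‖t‖ = 0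
    · rw [ht0]; positivity
    · have hpos : 0 < ‖t‖ := lt_of_le_of_ne (norm_nonneg _) (Ne.symm ht0)
      have h4 : ‖t‖ * ‖t‖ ≤ ‖t‖ * (β * ‖r - q‖) := by linarith
      have h5 := le_of_mul_le_mul_left h4 hpos
      refine h5.trans ?_
      gcongr
  have hTr : ‖T.starProjection (r - x₀)‖ ≤ ‖t‖ + h := by
    rw [show r - x₀ = (r - q) - (x₀ - q) by abel, map_sub]
    refine (norm_sub_le _ _).trans ?_
    gcongr
    exact (Submodule.norm_starProjection_apply_le _ _).trans hx₀q.le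
  set D := ‖r - x₀‖ with hD
  have hD0 : 0 ≤ D := norm_nonneg _
  have hDle : D ≤ ‖T.starProjection (r - x₀)‖ + ‖Tᗮ.starProjection (r - x₀)‖ := by
    rw [hD]
    conv_lhs => rw [← Submodule.starProjection_add_starProjection_orthogonal (K := T) (r - x₀)]
    exact norm_add_le _ _
  have hDq : D ≤ ‖r - q‖ + ‖x₀ - q‖ := by
    rw [hD, show r - x₀ = (r - q) - (x₀ - q) by abel]
    exact norm_sub_le _ _
  have hqD : ‖r - q‖ ≤ D + ‖x₀ - q‖ := by
    rw [hD]
    have := norm_add_le (r - x₀) (x₀ - q)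
    rwa [sub_add_sub_cancel] at this
  -- Here `D ≤ 2τ/3 + τ/6 = 5τ/6`, so Federer's quadratic term can be absorbed; this step rules out
  -- remote sheets.
  have hsq : D ^ 2 / (2 * τ) ≤ 5 / 12 * D := by
    rw [div_le_iff₀ (by positivity)]
    nlinarith
  linarith

/-- The minimizing pair is close to the tangent bundle: there is a sample point `x₀` near `q` and `r`
such that secants of `M` near `x₀` make small angles with the minimizing subspace. -/
theorem exists_localCoord_flat (hk : 2 ≤ k) (hM : IsClosedSubmanifold d k M)
    (ρ c₁ c₂ c₃ c₄ : ℝ) {δ κ : ℝ} (hδ : 0 < δ) (hc₁ : 1 ≤ c₁) (hc₂ : 3 ≤ c₂) (hc₃ : 0 < c₃)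
    (hκ : 0 < κ) :
    ∃ h₀ > 0, ∃ r₁ > 0, ∀ h : ℝ, 0 < h → h < h₀ →
      ∀ X : Finset (EuclideanSpace ℝ (Fin n)), IsSampleSet d M h ρ δ X →
      ∀ θ : ℝ → ℝ, IsWeight h c₁ c₂ c₃ c₄ θ → ∀ r ∈ M, ∀ (q : EuclideanSpace ℝ (Fin n))
        (H : AffineSubspace ℝ (EuclideanSpace ℝ (Fin n))), IsLocalCoord d M h X θ r q H →
      ∃ x₀ ∈ X, ‖x₀ - q‖ < h ∧ ‖r - x₀‖ ≤ 4 * h ∧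
        ∀ y ∈ M, ∀ y' ∈ M, ‖y - x₀‖ < r₁ → ‖y' - x₀‖ < r₁ →
          ‖H.directionᗮ.starProjection (y - y')‖ ≤ κ * ‖y - y'‖ := by
  rcases eq_zero_or_pos (reach M) with hreach | hreach
  · refine ⟨1, one_pos, 1, one_pos, ?_⟩
    intro h _ _ X _ θ _ r _ q H hq
    have := hq.1.search
    simp [hreach] at this
  -- For `h < 1` the length `‖r - q‖` is at most the diameter plus one.
  obtain ⟨τ, hτ, hτuniq, hτreach⟩ := exists_reach_radius hreach (Metric.diam M + 1)
  obtain ⟨K, hK, hKT⟩ := exists_tangent hk hM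
  obtain ⟨ε, hε, hgraph⟩ := exists_graph (by omega) hM (r₁ := 1 / (2 * K)) (by positivity)
  set κs := min 1 (δ / 8) with hκs
  have hκs0 : 0 < κs := by positivity
  have hκs2 : κs ^ 2 ≤ δ / 8 := by
    have h1 : κs ≤ 1 := min_le_left _ _
    have h2 : κs ≤ δ / 8 := min_le_right _ _
    nlinarith
  set B := K * (c₁ + 1) ^ 2 + 1 + (c₁ + 1) with hB
  -- Makes `c₃ (A h²)²` equal to the bound of `IsLocalCoord.cost_le`.
  set A := √(|ρ| * c₁ ^ d * (B ^ 2 * |c₄|) / c₃) with hA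
  have hA0 : 0 ≤ A := Real.sqrt_nonneg _
  set C := 8 * (2 * A + 9 * K) / δ ^ 2 with hC
  have hC0 : 0 < C := by positivity
  -- The tilt satisfies `C h ≤ 1/12`, as needed to locate `r`, and `C h ≤ κ/2`; within radius `κ /
  -- (4K)` curvature uses the other half of `κ`.
  refine ⟨min (min 1 (ε / 2)) (min (κs / (4 * K)) (min (τ / 6) (min (1 / (12 * C)) (κ / (2 * C))))),
    by positivity, κ / (4 * K), by positivity, ?_⟩
  intro h h0 hh X hX θ hθ r hr q H hq
  simp only [lt_min_iff] at hh
  obtain ⟨⟨hh1, hhε⟩, hhK, hhτ, hhC, hhκ⟩ := hh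
  rw [lt_div_iff₀ (by positivity)] at hhK hhC hhκ
  obtain ⟨x₀, hx₀, hx₀q⟩ := hq.1.proximity
  have hx₀q' : ‖x₀ - q‖ < h := by rwa [← dist_eq_norm]
  have hx₀M : x₀ ∈ M := hX.subset hx₀
  have hsq : ∀ p ∈ M, ∃ T : Submodule ℝ (EuclideanSpace ℝ (Fin n)), Module.finrank ℝ T = d ∧
      (∀ y ∈ M, ‖Tᗮ.starProjection (y - p)‖ ≤ K * ‖y - p‖ ^ 2) ∧
      ∀ y ∈ M, ∀ y' ∈ M,
        ‖Tᗮ.starProjection (y - y')‖ ≤ K * (‖y - p‖ + ‖y' - p‖) * ‖y - y'‖ := by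
    intro p hp
    obtain ⟨T, hTd, hT⟩ := hKT p hp
    refine ⟨T, hTd, fun y hy => (hT y hy p hp).trans_eq ?_, hT⟩
    rw [sub_self, norm_zero, add_zero]
    ring
  have hJ : J X θ q H ≤ c₃ * (A * h ^ 2) ^ 2 := by
    obtain ⟨T, hTd, hT, -⟩ := hsq r hr
    refine (hq.cost_le hr h0 hh1.le hc₁ hX hθ hTd hK.le hT).trans_eq ?_
    rw [mul_pow A, hA, Real.sq_sqrt (by positivity)]
    field_simp
    rw [hB]
    ring
  obtain ⟨T, hTd, hT, hT2⟩ := hsq x₀ hx₀M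
  let e : OrthonormalBasis (Fin d) ℝ T := (stdOrthonormalBasis ℝ T).reindex (finCongr hTd)
  have hpair : (x₀, coords e) ∈ graphPairs M (1 / (2 * K)) := by
    refine mem_graphPairs_of_flat hx₀M e fun y hy hyr => (hT y hy).trans ?_
    rw [lt_div_iff₀ (by positivity)] at hyr
    nlinarith [norm_nonneg (y - x₀)]
  obtain ⟨Y, hYc, hY0, hY⟩ := hgraph _ hpair
  have htilt : ∀ v ∈ T, ‖H.directionᗮ.starProjection v‖ ≤ C * h * ‖v‖ :=
    hX.norm_perp_le_of_near h0 hδ hx₀ hx₀q e hκs0.le hκs2 hK.le hT (by linarith) hYc hY0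
      (fun x hx => ⟨(hY x hx).1, (hY x hx).2.1⟩) (by linarith)
      (fun x hx hxq => norm_perp_le_of_cost_le hq.1.mem hc₃ hθ hJ hA0 hx
        (hxq.trans (by gcongr)))
  have hrq : ‖r - q‖ ≤ 2 / 3 * τ := by
    refine hτreach _ ?_ ?_
    · have h1 := norm_add_le (r - x₀) (x₀ - q)
      rw [sub_add_sub_cancel] at h1
      have h2 := Metric.dist_le_diam_of_mem hM.isCompact.isBounded hr hx₀M
      rw [dist_eq_norm] at h2
      linarith
    · have := hq.1.search
      rwa [edist_comm, edist_dist, dist_eq_norm] at this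
  have hF := norm_perp_le_of_unique_nearest hM.isCompact hτ hτuniq hx₀M hK hT hr
  refine ⟨x₀, hx₀, hx₀q', norm_sub_le_of_reach (β := C * h) ?_ htilt hq.1.perp hτ hF hx₀q' hrq
    hhτ.le, ?_⟩
  · rw [le_div_iff₀ (by norm_num)]
    linarith
  · intro y hy y' hy' hyx hyx'
    rw [lt_div_iff₀ (by positivity)] at hyx hyx'
    rw [← Submodule.starProjection_add_starProjection_orthogonal (K := T) (y - y'), map_add,
      Submodule.starProjection_add_starProjection_orthogonal]
    have e1 := htilt _ (Submodule.starProjection_apply_mem T (y - y'))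
    have e2 : ‖T.starProjection (y - y')‖ ≤ ‖y - y'‖ := Submodule.norm_starProjection_apply_le _ _
    have e3 := (norm_perp_le H.direction (Tᗮ.starProjection (y - y'))).trans (hT2 y hy y' hy')
    have hn := norm_nonneg (y - y')
    calc _ ≤ C * h * ‖T.starProjection (y - y')‖ + K * (‖y - x₀‖ + ‖y' - x₀‖) * ‖y - y'‖ :=
          (norm_add_le _ _).trans (add_le_add e1 e3)
      _ ≤ C * h * ‖y - y'‖ + K * (‖y - x₀‖ + ‖y' - x₀‖) * ‖y - y'‖ := by gcongr
      _ = (C * h + K * (‖y - x₀‖ + ‖y' - x₀‖)) * ‖y - y'‖ := by ring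
      _ ≤ κ * ‖y - y'‖ := by
          gcongr
          linarith

end Geometry


/-! ### Stability of the least-squares problem. -/

section Stability

variable {n d m k : ℕ} {M : Set (EuclideanSpace ℝ (Fin n))} {h ρ δ c₁ c₂ c₃ c₄ : ℝ}
  {X : Finset (EuclideanSpace ℝ (Fin n))} {θ : ℝ → ℝ}

/-- Affine functions are controlled at the origin by their values at a set of points that meets all
directions around one of its points. -/
theorem abs_eval_zero_le_of_affine {p : MvPolynomial (Fin d) ℝ} (hp : p.totalDegree ≤ 1)
    {S : Set (EuclideanSpace ℝ (Fin d))} {y₀ : EuclideanSpace ℝ (Fin d)} (hy₀ : y₀ ∈ S) {a : ℝ}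
    (ha : 0 < a) (h0 : 0 < h) (hy₀h : ‖y₀‖ ≤ h)
    (hS : ∀ b : EuclideanSpace ℝ (Fin d), ‖b‖ = 1 → ∃ y ∈ S, a * h ≤ inner ℝ b (y - y₀))
    {B : ℝ} (hB : ∀ y ∈ S, |MvPolynomial.eval y p| ≤ B) :
    |MvPolynomial.eval 0 p| ≤ (1 + 2 / a) * B ∧ (B = 0 → p = 0) := by
  obtain ⟨α, β, hαβ⟩ := exists_affine hp
  have h00 : MvPolynomial.eval 0 p = α := by
    have := hαβ 0
    rwa [inner_zero_right, add_zero] at this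
  -- Test the spread in the direction of the gradient `β`: two values of `p` differ by at most `2B`.
  have hβ : ‖β‖ * (a * h) ≤ 2 * B := by
    by_cases hβ0 : β = 0
    · rw [hβ0, norm_zero, zero_mul]
      have := (abs_nonneg _).trans (hB y₀ hy₀)
      linarith
    · have hn : 0 < ‖β‖ := norm_pos_iff.2 hβ0
      obtain ⟨y, hy, hyb⟩ := hS _ (norm_inv_smul_self hβ0)
      rw [inner_smul_left, conj_trivial, inv_mul_eq_div, le_div_iff₀ hn] at hyb
      have h1 := (abs_le.1 (hB y hy)).2
      have h2 := (abs_le.1 (hB y₀ hy₀)).1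
      rw [hαβ] at h1 h2
      rw [inner_sub_right] at hyb
      linarith
  have hβh : ‖β‖ * h ≤ 2 / a * B := by
    rw [div_mul_eq_mul_div, le_div_iff₀ ha]
    linarith
  refine ⟨?_, ?_⟩
  · have h1 := hB y₀ hy₀
    rw [hαβ] at h1
    have h2 : |inner ℝ β y₀| ≤ ‖β‖ * h :=
      (abs_real_inner_le_norm _ _).trans (by gcongr)
    rw [h00]
    have h3 : |α| ≤ |α + inner ℝ β y₀| + |inner ℝ β y₀| := by
      simpa using abs_sub (α + inner ℝ β y₀) (inner ℝ β y₀)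
    linarith
  · intro hB0
    have hβ0 : β = 0 := by
      rw [hB0, mul_zero] at hβ
      rw [← norm_le_zero_iff]
      by_contra hcon
      push Not at hcon
      have := mul_pos hcon (mul_pos ha h0)
      linarith
    have hα0 : α = 0 := by
      have h1 := hB y₀ hy₀
      rw [hαβ, hβ0, inner_zero_left, add_zero, hB0] at h1
      exact abs_eq_zero.1 (le_antisymm h1 (abs_nonneg _))
    refine MvPolynomial.funext fun x => ?_
    have := hαβ (WithLp.toLp 2 x)
    rw [hβ0, hα0, inner_zero_left, add_zero] at this
    simpa using this

/-- The least-squares problem at the sample points of a graph is stable for affine polynomials. -/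
theorem IsSampleSet.stable_affine (hX : IsSampleSet d M h ρ δ X) (h0 : 0 < h) (hδ : 0 < δ)
    (hc₂ : 3 ≤ c₂) {x₀ q r : EuclideanSpace ℝ (Fin n)} (hx₀ : x₀ ∈ X) (hx₀q : ‖x₀ - q‖ < h)
    {W : Submodule ℝ (EuclideanSpace ℝ (Fin n))} (e : OrthonormalBasis (Fin d) ℝ W)
    (hperp : ∀ v ∈ W, inner ℝ v (r - q) = 0) {κ ε : ℝ} (hκ0 : 0 ≤ κ) (hκ : κ ^ 2 ≤ δ / 8)
    (hflat : ∀ y ∈ M, ‖y - x₀‖ ≤ 4 * h → ‖Wᗮ.starProjection (y - x₀)‖ ≤ κ * ‖y - x₀‖)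
    {Y : EuclideanSpace ℝ (Fin d) → EuclideanSpace ℝ (Fin n)}
    (hYc : ContinuousOn Y (Metric.ball 0 ε)) (hY0 : Y 0 = x₀)
    (hY : ∀ x ∈ Metric.ball (0 : EuclideanSpace ℝ (Fin d)) ε, Y x ∈ M ∧ coords e (Y x - x₀) = x)
    (hε : 2 * h < ε) {p : MvPolynomial (Fin d) ℝ} (hp : p.totalDegree ≤ 1) {B : ℝ}
    (hB : ∀ x ∈ X, ‖x - q‖ ≤ c₂ * h → |MvPolynomial.eval (coords e (x - r)) p| ≤ B) :
    |MvPolynomial.eval 0 p| ≤ (1 + 2 / (δ ^ 2 / 8)) * B ∧ (B = 0 → p = 0) := by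
  have hn0 := norm_nonneg (x₀ - q)
  have hc₂h : 3 * h ≤ c₂ * h := by gcongr
  set h' := h + (h - ‖x₀ - q‖) / 2 with hh'
  have hx₀r : coords e (x₀ - r) = coords e (x₀ - q) := by
    rw [show x₀ - r = (x₀ - q) - (r - q) by abel, map_sub, coords_eq_zero_of_perp e hperp, sub_zero]
  refine abs_eval_zero_le_of_affine hp
    (S := (fun x => coords e (x - r)) '' {x | x ∈ X ∧ ‖x - q‖ ≤ c₂ * h})
    (y₀ := coords e (x₀ - r)) ⟨x₀, ⟨hx₀, by linarith⟩, rfl⟩ (by positivity) h0 ?_ ?_ ?_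
  · rw [hx₀r]
    exact (norm_coords_le e _).trans hx₀q.le
  · intro b hb
    obtain ⟨x, hx, hxx, hin⟩ := hX.exists_in_direction h0 hδ hx₀ e hκ0 hκ hflat hYc hY0 hY
      (h' := h') (by rw [hh']; linarith) (by rw [hh']; linarith) (by rw [hh']; linarith) hb
    refine ⟨_, ⟨x, ⟨hx, ?_⟩, rfl⟩, ?_⟩
    · have := norm_add_le (x - x₀) (x₀ - q)
      rw [sub_add_sub_cancel] at this
      rw [hh'] at hxx
      linarith
    · simp only
      rw [← map_sub, sub_sub_sub_cancel_right]
      linarith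
  · rintro _ ⟨x, ⟨hx, hxq⟩, rfl⟩
    exact hB x hx hxq

/-- The least-squares problem at the sample points of a graph is stable for polynomials of a given
degree, provided that a sufficiently large ball is sampled. -/
theorem IsSampleSet.stable_of_norming (hX : IsSampleSet d M h ρ δ X) (h0 : 0 < h)
    {η R : ℝ} (hR : 1 ≤ R) (hRη : 2 < η * R) (hc₂ : 2 * R + 6 ≤ c₂)
    (hnorm : ∀ ρ : ℝ, 0 < ρ → ∀ p : MvPolynomial (Fin d) ℝ, p.totalDegree ≤ m →
      ∀ S : Set (EuclideanSpace ℝ (Fin d)), S ⊆ Metric.closedBall 0 ρ →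
        (∀ x ∈ Metric.closedBall (0 : EuclideanSpace ℝ (Fin d)) ρ, ∃ s ∈ S, dist s x < η * ρ) →
      ∀ B : ℝ, (∀ s ∈ S, |MvPolynomial.eval s p| ≤ B) →
      ∀ x ∈ Metric.closedBall (0 : EuclideanSpace ℝ (Fin d)) ρ, |MvPolynomial.eval x p| ≤ 2 * B)
    {q r : EuclideanSpace ℝ (Fin n)} (hrq : ‖r - q‖ ≤ 5 * h)
    {W : Submodule ℝ (EuclideanSpace ℝ (Fin n))} (e : OrthonormalBasis (Fin d) ℝ W) {ε : ℝ}
    {Y : EuclideanSpace ℝ (Fin d) → EuclideanSpace ℝ (Fin n)}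
    (hY : ∀ x ∈ Metric.ball (0 : EuclideanSpace ℝ (Fin d)) ε,
      Y x ∈ M ∧ coords e (Y x - r) = x ∧ ‖Y x - r‖ ≤ 2 * ‖x‖)
    (hε : R * h < ε) {p : MvPolynomial (Fin d) ℝ} (hp : p.totalDegree ≤ m) {B : ℝ}
    (hB : ∀ x ∈ X, ‖x - q‖ ≤ c₂ * h → |MvPolynomial.eval (coords e (x - r)) p| ≤ B) :
    |MvPolynomial.eval 0 p| ≤ 2 * B ∧ (B = 0 → p = 0) := by
  have hρ : 0 < R * h := by positivity
  have key := hnorm (R * h) hρ p hp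
    ((fun x => coords e (x - r)) '' {x | x ∈ X ∧ ‖x - q‖ ≤ c₂ * h} ∩ Metric.closedBall 0 (R * h))
    Set.inter_subset_right ?_ B ?_
  · refine ⟨key 0 (Metric.mem_closedBall_self hρ.le), fun hB0 => ?_⟩
    refine eq_zero_of_eval_eq_zero_on_ball hρ fun x hx => ?_
    have := key x hx
    rw [hB0, mul_zero] at this
    exact abs_eq_zero.1 (le_antisymm this (abs_nonneg _))
  · intro ξ hξ
    rw [mem_closedBall_zero_iff] at hξ
    have hR1 : 0 ≤ 1 - 1 / R := by
      rw [sub_nonneg, div_le_one (by positivity)]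
      exact hR
    -- Contracting by at most `h` keeps the coordinates of the covering sample in the ball; the
    -- total displacement is at most `2h < η R h`.
    set ξ' := (1 - 1 / R) • ξ with hξ'
    have hξ'n : ‖ξ'‖ ≤ R * h - h := by
      rw [hξ', norm_smul, Real.norm_of_nonneg hR1]
      calc (1 - 1 / R) * ‖ξ‖ ≤ (1 - 1 / R) * (R * h) := by gcongr
        _ = R * h - h := by field_simp
    have hξξ' : ‖ξ' - ξ‖ ≤ h := by
      rw [hξ', sub_smul, one_smul, sub_sub_cancel_left, norm_neg, norm_smul,
        Real.norm_of_nonneg (by positivity)]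
      calc 1 / R * ‖ξ‖ ≤ 1 / R * (R * h) := by gcongr
        _ = h := by field_simp
    obtain ⟨hyM, hyx, hyr⟩ := hY ξ' (by rw [mem_ball_zero_iff]; linarith)
    obtain ⟨x, hx, hxy⟩ := hX.exists_dist_le hyM
    rw [dist_comm, dist_eq_norm] at hxy
    have hcx : ‖coords e (x - r) - ξ'‖ ≤ h := by
      nth_rewrite 1 [← hyx]
      rw [← map_sub, sub_sub_sub_cancel_right]
      exact (norm_coords_le e _).trans hxy
    refine ⟨coords e (x - r), ⟨⟨x, ⟨hx, ?_⟩, rfl⟩, ?_⟩, ?_⟩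
    -- The sum is at most `h + 2(R - 1)h + 5h`, below `(2R + 6)h`.
    · have h1 : ‖x - q‖ ≤ ‖x - Y ξ'‖ + ‖Y ξ' - r‖ + ‖r - q‖ := by
        rw [show x - q = (x - Y ξ') + (Y ξ' - r) + (r - q) by abel]
        exact norm_add₃_le
      have h2 : (2 * R + 6) * h ≤ c₂ * h := by gcongr
      linarith
    · rw [mem_closedBall_zero_iff]
      have := norm_add_le (coords e (x - r) - ξ') ξ'
      rw [sub_add_cancel] at this
      linarith
    · rw [dist_eq_norm]
      have := norm_add_le (coords e (x - r) - ξ') (ξ' - ξ)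
      rw [sub_add_sub_cancel] at this
      have h3 : 2 * h < η * R * h := by gcongr
      linarith
  · rintro _ ⟨⟨x, ⟨hx, hxq⟩, rfl⟩, -⟩
    exact hB x hx hxq

/-- Since `r - q` is orthogonal to `W`, coordinates with origin `q` and with origin `r` coincide;
this is why the fit at `0` estimates `ψ r`. -/
theorem fitCost_eq_lsCost {ψ : EuclideanSpace ℝ (Fin n) → ℝ} {q r : EuclideanSpace ℝ (Fin n)}
    {W : Submodule ℝ (EuclideanSpace ℝ (Fin n))} (e : OrthonormalBasis (Fin d) ℝ W)
    (hperp : ∀ v ∈ W, inner ℝ v (r - q) = 0) (p : MvPolynomial (Fin d) ℝ) :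
    fitCost X θ ψ q e p =
      lsCost X (fun x => θ ‖x - q‖) ψ (fun x => (coords e (x - r)).ofLp) p := by
  refine Finset.sum_congr rfl fun x _ => ?_
  have : (fun j => inner ℝ (e j : EuclideanSpace ℝ (Fin n)) (x - q)) = (coords e (x - r)).ofLp := by
    have h1 : coords e (x - r) = coords e (x - q) := by
      rw [show x - r = (x - q) - (r - q) by abel, map_sub, coords_eq_zero_of_perp e hperp, sub_zero]
    rw [h1]
    ext j
    exact (coords_apply e _ j).symm
  rw [this]

/-- A stable weighted least-squares problem has a unique solution, whose value at the origin is as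
accurate as the best available polynomial approximation. -/
theorem IsWeight.fit_of_stable {ψ : EuclideanSpace ℝ (Fin n) → ℝ}
    (hX : IsSampleSet d M h ρ δ X) (hθ : IsWeight h c₁ c₂ c₃ c₄ θ) (hc₁ : 1 ≤ c₁) (hc₃ : 0 < c₃)
    {q r : EuclideanSpace ℝ (Fin n)} {W : Submodule ℝ (EuclideanSpace ℝ (Fin n))}
    (e : OrthonormalBasis (Fin d) ℝ W) (hperp : ∀ v ∈ W, inner ℝ v (r - q) = 0) {Λ η : ℝ}
    (hη : 0 ≤ η)
    (hstab : ∀ p : MvPolynomial (Fin d) ℝ, p.totalDegree ≤ m → ∀ B : ℝ,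
      (∀ x ∈ X, ‖x - q‖ ≤ c₂ * h → |MvPolynomial.eval (coords e (x - r)) p| ≤ B) →
      |MvPolynomial.eval 0 p| ≤ Λ * B ∧ (B = 0 → p = 0))
    {P : MvPolynomial (Fin d) ℝ} (hP : P.totalDegree ≤ m) (hP0 : MvPolynomial.eval 0 P = ψ r)
    (hPη : ∀ x ∈ X, ‖x - q‖ ≤ c₁ * h → |MvPolynomial.eval (coords e (x - r)) P - ψ x| ≤ η) :
    (∃! p : MvPolynomial (Fin d) ℝ, IsFit m X θ ψ q e p) ∧
      ∀ p : MvPolynomial (Fin d) ℝ, IsFit m X θ ψ q e p →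
        |MvPolynomial.eval 0 p - ψ r| ≤ Λ * ((√(|ρ| * c₁ ^ d * |c₄| / c₃) + 1) * η) := by
  have hw : ∀ x ∈ X, 0 ≤ θ ‖x - q‖ := fun x _ => hθ.nonneg _ (norm_nonneg _)
  have hlow : ∀ x ∈ X, ‖x - q‖ ≤ c₂ * h → c₃ ≤ θ ‖x - q‖ := fun x _ hxq =>
    hθ.lower_le (norm_nonneg _) hxq
  have hres : ∀ x ∈ X, θ ‖x - q‖ ≠ 0 → |MvPolynomial.eval (coords e (x - r)) P - ψ x| ≤ η :=
    fun x hx hxθ => hPη x hx (hθ.le_of_ne_zero (norm_nonneg _) hxθ)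
  refine ⟨?_, ?_⟩
  -- Stability with `B = 0` says that the samples of weight at least `c₃` determine the polynomial.
  · have := existsUnique_lsCost_min (X := X) (w := fun x => θ ‖x - q‖) (b := ψ)
      (x := fun x => (coords e (x - r)).ofLp) hw (m := m) (fun p hp hzero =>
        (hstab p hp 0 fun x hx hxq => by
          rw [hzero x hx (hc₃.trans_le (hlow x hx hxq)).ne', abs_zero]).2 rfl)
    simpa only [IsFit, fitCost_eq_lsCost e hperp] using this
  · intro p hp
    have hpP : lsCost X (fun x => θ ‖x - q‖) ψ (fun x => (coords e (x - r)).ofLp) p ≤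
        lsCost X (fun x => θ ‖x - q‖) ψ (fun x => (coords e (x - r)).ofLp) P := by
      have := hp.2 P hP
      rwa [fitCost_eq_lsCost e hperp, fitCost_eq_lsCost e hperp] at this
    set s := √(|ρ| * c₁ ^ d * |c₄| / c₃) with hs
    have hs0 : 0 ≤ s := Real.sqrt_nonneg _
    have hs2 : s ^ 2 * c₃ = |ρ| * c₁ ^ d * |c₄| := by
      rw [hs, Real.sq_sqrt (by positivity)]
      field_simp
    -- At those samples `p - P` is bounded by the residual `s η` of `p` plus the residual `η` of
    -- `P`.
    have hbound := (hstab (p - P) ((MvPolynomial.totalDegree_sub _ _).trans (max_le hp.1 hP))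
      ((s + 1) * η) fun x hx hxq => ?_).1
    · rwa [map_sub, hP0] at hbound
    · have hcx := hlow x hx hxq
      have h1 := sq_residual_le (X := X) (w := fun x => θ ‖x - q‖) (b := ψ)
        (x := fun x => (coords e (x - r)).ofLp) hw (c₄ := |c₄|) (N := |ρ| * c₁ ^ d)
        (fun x _ => (hθ.le_upper (norm_nonneg _)).trans (le_abs_self _)) (abs_nonneg _)
        ((card_weight_ne_zero_le hX hθ hc₁ q).trans (by gcongr; exact le_abs_self _))
        hpP hres hx hcx
      rw [← hs2] at h1
      have h2 : (MvPolynomial.eval (coords e (x - r)) p - ψ x) ^ 2 ≤ (s * η) ^ 2 := by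
        have : c₃ * (MvPolynomial.eval (coords e (x - r)) p - ψ x) ^ 2 ≤ c₃ * (s * η) ^ 2 := by
          linarith
        exact le_of_mul_le_mul_left this hc₃
      have h3 := abs_le_of_sq_le_sq h2 (by positivity)
      have h4 := hres x hx (hc₃.trans_le hcx).ne'
      rw [map_sub]
      calc _ = |(MvPolynomial.eval (coords e (x - r)) p - ψ x) -
            (MvPolynomial.eval (coords e (x - r)) P - ψ x)| := by congr 1; ring
        _ ≤ _ := abs_sub _ _
        _ ≤ s * η + η := add_le_add h3 h4
        _ = _ := by ring

end Stability

end MMLS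

/-! ### Choice of constants and conclusion. -/

theorem theorem3p2 (d m : ℕ) :
    ∃ k : ℝ, 3 ≤ k ∧ (m ≤ 1 → k = 3) ∧
      ∀ (n : ℕ) (M : Set (EuclideanSpace ℝ (Fin n))) (ψ : EuclideanSpace ℝ (Fin n) → ℝ),
        MMLS.IsClosedSubmanifold d (max 2 (m + 1)) M →
        MMLS.IsCkOn (m + 1) M ψ →
        ∀ ρ δ c₁ c₂ c₃ c₄ : ℝ, 0 < δ → 2 < c₁ → k ≤ c₂ → 0 < c₃ →
        ∃ h₀ : ℝ, 0 < h₀ ∧ ∃ C : ℝ, 0 < C ∧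
          ∀ h : ℝ, 0 < h → h < h₀ →
          ∀ X : Finset (EuclideanSpace ℝ (Fin n)), MMLS.IsSampleSet d M h ρ δ X →
          ∀ θ : ℝ → ℝ, MMLS.IsWeight h c₁ c₂ c₃ c₄ θ →
          ∀ r ∈ M, ∀ (q : EuclideanSpace ℝ (Fin n))
            (H : AffineSubspace ℝ (EuclideanSpace ℝ (Fin n))),
            MMLS.IsLocalCoord d M h X θ r q H →
          ∀ e : OrthonormalBasis (Fin d) ℝ H.direction,
            (∃! p : MvPolynomial (Fin d) ℝ, MMLS.IsFit m X θ ψ q e p) ∧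
            ∀ p : MvPolynomial (Fin d) ℝ, MMLS.IsFit m X θ ψ q e p →
              |MvPolynomial.eval 0 p - ψ r| < C * h ^ (m + 1) := by
  obtain ⟨η, hη, hη1, hnorm⟩ := MMLS.exists_norming d m
  set R := 3 / η with hR
  have hR1 : 1 ≤ R := by
    rw [hR, le_div_iff₀ hη]
    linarith
  have hRη : 2 < η * R := by
    rw [hR, mul_div_cancel₀ _ hη.ne']
    norm_num
  refine ⟨if m ≤ 1 then 3 else 2 * R + 6, ?_, fun hm => if_pos hm, ?_⟩
  · split_ifs
    · exact le_rfl
    · linarith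
  intro n M ψ hM hψ ρ δ c₁ c₂ c₃ c₄ hδ hc₁ hkc₂ hc₃
  have hc₂ : 3 ≤ c₂ := by
    refine le_trans ?_ hkc₂
    split_ifs
    · exact le_rfl
    · linarith
  have hc₁1 : 1 ≤ c₁ := by linarith
  -- The bound `1/2` makes the manifold a graph over `H`; `κ² ≤ δ/8` is needed to find samples in
  -- every direction.
  set κ := min (1 / 2) (δ / 8) with hκ
  have hκ0 : 0 < κ := by positivity
  have hκ1 : κ ≤ 1 / 2 := min_le_left _ _
  have hκ2 : κ ^ 2 ≤ δ / 8 := by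
    have : κ ≤ δ / 8 := min_le_right _ _
    nlinarith
  obtain ⟨h₁, hh₁, r₁, hr₁, hflat⟩ := MMLS.exists_localCoord_flat (le_max_left _ _) hM ρ c₁ c₂ c₃ c₄
    hδ hc₁1 hc₂ hc₃ hκ0
  obtain ⟨ε, hε, hgraph⟩ := MMLS.exists_graph (le_trans (by norm_num) (le_max_left 2 (m + 1))) hM
    (half_pos hr₁)
  obtain ⟨ε', hε', C, hC, happrox⟩ := MMLS.exists_polynomial_approx (le_max_right _ _) hM hψ
    (half_pos hr₁)
  -- Dominates the stability constants of both cases, `1 + 2 / (δ² / 8)` and `2`.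
  set Λ := 2 + 2 / (δ ^ 2 / 8) with hΛ
  have hΛ0 : 0 < Λ := by positivity
  set s := √(|ρ| * c₁ ^ d * |c₄| / c₃) with hs
  have hs0 : 0 ≤ s := Real.sqrt_nonneg _
  -- The caps give `4h < r₁/2`, graphs of radius `2h` and `R h`, and Taylor control up to `(c₁ +
  -- 5)h`, where samples of nonzero weight lie; the final `+ 1` makes the estimate strict.
  refine ⟨min (min h₁ (r₁ / 8)) (min (ε / (R + 2)) (ε' / (c₁ + 5))), by positivity,
    Λ * ((s + 1) * (C * (c₁ + 5) ^ (m + 1))) + 1, by positivity, ?_⟩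
  intro h h0 hh X hX θ hθ r hr q H hq e
  simp only [lt_min_iff] at hh
  obtain ⟨⟨hhh₁, hhr⟩, hhε, hhε'⟩ := hh
  rw [lt_div_iff₀ (by positivity)] at hhε hhε'
  obtain ⟨x₀, hx₀, hx₀q, hrx₀, hW⟩ := hflat h h0 hhh₁ X hX θ hθ r hr q H hq
  have hx₀M : x₀ ∈ M := hX.subset hx₀
  have hrq : ‖r - q‖ ≤ 5 * h := by
    have := norm_add_le (r - x₀) (x₀ - q)
    rw [sub_add_sub_cancel] at this
    linarith
  have hpair : ∀ p ∈ M, ‖p - x₀‖ ≤ 4 * h → (p, MMLS.coords e) ∈ MMLS.graphPairs M (r₁ / 2) := by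
    intro p hp hpx
    refine MMLS.mem_graphPairs_of_flat hp e fun y hy hyp => ?_
    have h1 : ‖y - x₀‖ ≤ ‖y - p‖ + ‖p - x₀‖ := by
      have := norm_add_le (y - p) (p - x₀)
      rwa [sub_add_sub_cancel] at this
    refine (hW y hy p hp (by linarith) (by linarith)).trans ?_
    gcongr
  have hpr := hpair r hr hrx₀
  have hpx := hpair x₀ hx₀M (by rw [sub_self, norm_zero]; positivity)
  have hB0 : ∀ (p : MvPolynomial (Fin d) ℝ) (B : ℝ),
      (∀ x ∈ X, ‖x - q‖ ≤ c₂ * h → |MvPolynomial.eval (MMLS.coords e (x - r)) p| ≤ B) → 0 ≤ B :=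
    fun p B hB => (abs_nonneg _).trans (hB x₀ hx₀ (by nlinarith))
  have hstab : ∀ p : MvPolynomial (Fin d) ℝ, p.totalDegree ≤ m → ∀ B : ℝ,
      (∀ x ∈ X, ‖x - q‖ ≤ c₂ * h → |MvPolynomial.eval (MMLS.coords e (x - r)) p| ≤ B) →
      |MvPolynomial.eval 0 p| ≤ Λ * B ∧ (B = 0 → p = 0) := by
    intro p hp B hB
    have hBn := hB0 p B hB
    -- The affine case uses the graph based at the sample `x₀` and stays within `3h` of `q`, hence
    -- `k = 3`; the general case uses the graph based at `r`.
    by_cases hm : m ≤ 1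
    · obtain ⟨Y, hYc, hY0, hY⟩ := hgraph _ hpx
      have := hX.stable_affine h0 hδ hc₂ hx₀ hx₀q e hq.1.perp hκ0.le hκ2
        (fun y hy hyx => hW y hy x₀ hx₀M (by linarith)
          (by rw [sub_self, norm_zero]; exact hr₁)) hYc hY0
        (fun x hx => ⟨(hY x hx).1, (hY x hx).2.1⟩) (by nlinarith) (hp.trans hm) hB
      refine ⟨this.1.trans ?_, this.2⟩
      gcongr
      rw [hΛ]
      gcongr
      norm_num
    · rw [if_neg hm] at hkc₂
      obtain ⟨Y, -, -, hY⟩ := hgraph _ hpr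
      have := hX.stable_of_norming h0 hR1 hRη hkc₂ hnorm hrq e hY (by nlinarith) hp hB
      refine ⟨this.1.trans ?_, this.2⟩
      gcongr
      rw [hΛ]
      exact le_add_of_nonneg_right (by positivity)
  obtain ⟨P, hP, hP0, hPx⟩ := happrox _ hpr
  obtain ⟨hex, hbound⟩ := hθ.fit_of_stable hX hc₁1 hc₃ e hq.1.perp
    (η := C * ((c₁ + 5) * h) ^ (m + 1)) (by positivity) hstab hP hP0 (fun x hx hxq => by
      have h1 : ‖x - r‖ ≤ (c₁ + 5) * h := by
        have := norm_sub_le (x - q) (r - q)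
        rw [sub_sub_sub_cancel_right] at this
        linarith
      refine (hPx x (hX.subset hx) (by linarith)).trans ?_
      gcongr)
  refine ⟨hex, fun p hp => (hbound p hp).trans_lt ?_⟩
  rw [← hs, mul_pow]
  have : 0 < h ^ (m + 1) := by positivity
  linarith
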